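/- BIPASS is a two-player game, played under the normal-play convention (a player who cannot move loses). A strip is a non-empty finite row of black and white stones all of which are alive: every black stone has a white stone somewhere to its right and every white stone has a black stone somewhere to its left. A move on a strip interchanges a black stone with a white stone lying to its right; Left may do so only if there is no black stone between the two, Right only if there is no white stone between them. After the move, all dead stones (black stones with no white stone to their right, white stones with no black stone to their left) are removed. In a disjunctive sum the player to move moves in exactly one component. For a strip $s$ let $\Delta(s)$ be the number of its white stones minus the number of its black stones, and for a sum $g=s_1+\cdots+s_n$ let $\Delta(g)=\sum_i\Delta(s_i)$. A larva is a strip consisting of one black stone followed by at least one white stone, or of at least one black stone followed by one white stone. Outcomes of games are partially ordered by $\mathrm L>\mathrm P>\mathrm R$, $\mathrm L>\mathrm N>\mathrm R$, with $\mathrm P$ and $\mathrm N$ incomparable. Write $G\ge H$ if $o(G+X)\ge o(H+X)$ for every normal-play game $X$; $G\equiv H$ if $G\ge H$ and $H\ge G$; $G>H$ if $G\ge H$ and not $H\ge G$; $G\parallel H$ ("$G$ is fuzzy with $H$") if neither $G\ge H$ nor $H\ge G$. Let $0=\{\,\mid\,\}$, $*=\{0\mid 0\}$, ${\uparrow}=\{0\mid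 *\}$, ${\downarrow}=\{*\mid 0\}$, ${\uparrow}*={\uparrow}+*$, ${\downarrow}*={\downarrow}+*$. **Theorem.** Let $g=\sum_{i=1}^n s_i$ be a disjunctive sum of $n\ge 0$ BIPASS strips with $\Delta(g)=0$. If $n$ is odd, then 1. $g\parallel 0$; and if moreover $s_i\equiv *$ for every $i$, then $g\equiv *$; 2. ${\downarrow}*<g<{\uparrow}*$; 3. (${\downarrow}<g$ or ${\downarrow}\parallel g$) and ($g<{\uparrow}$ or $g\parallel{\uparrow}$). If $n$ is even, then 4. $g\parallel *$; and if moreover every $s_i$ is a larva, then $g\equiv 0$; 5. ${\downarrow}<g<{\uparrow}$; 6. (${\downarrow}*<g$ or ${\downarrow}*\parallel g$) and ($g<{\uparrow}*$ or $g\parallel{\uparrow}*$). -/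

import Mathlib

namespace CGT

/-- Combinatorial games: a game is given by its families of Left options and of Right options
(so every play is finite). -/
inductive Game : Type 1
  | mk (α β : Type) (L : α → Game) (R : β → Game) : Game

namespace Game

/-- `LeftWins b G`: in normal play (a player who cannot move loses) Left has a winning strategy
in `G`, where Left moves first if `b = true` and Right moves first if `b = false`. -/
def LeftWins : Bool → Game → Prop
  | true, mk _ _ L _ => ∃ i, LeftWins false (L i)
  | false, mk _ _ _ R => ∀ j, LeftWins true (R j)

/-- The outcome of a game, recorded as the pair
(Left wins moving first, Left wins moving second). The four outcomes are
`L = (True, True)`, `N = (True, False)`, `P = (False, True)`, `R = (False, False)`, and the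
product order on `Prop × Prop` is the usual partial order of outcomes:
`L > P > R`, `L > N > R`, and `P`, `N` incomparable. -/
def outcome (G : Game) : Prop × Prop := (LeftWins true G, LeftWins false G)

/-- Auxiliary to the disjunctive sum: `H ↦ G + H`, when `f i` is `H ↦ Gᴸ + H` for the `i`-th Left
option of `G` and `g j` is `H ↦ Gᴿ + H` for the `j`-th Right option of `G`. -/
def addAux {α β : Type} (f : α → Game → Game) (g : β → Game → Game) : Game → Game
  | mk α' β' L' R' =>
    mk (α ⊕ α') (β ⊕ β')
      (Sum.elim (fun i => f i (mk α' β' L' R')) (fun i => addAux f g (L' i)))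
      (Sum.elim (fun j => g j (mk α' β' L' R')) (fun j => addAux f g (R' j)))

/-- Disjunctive sum: the player to move moves in exactly one of the two components
(see `add_mk_mk` for the recursion). -/
def add : Game → Game → Game
  | mk _ _ L R => addAux (fun i => add (L i)) (fun j => add (R j))

instance : Add Game := ⟨add⟩

theorem add_mk_mk {α β α' β' : Type} (L : α → Game) (R : β → Game) (L' : α' → Game)
    (R' : β' → Game) :
    mk α β L R + mk α' β' L' R' =
      mk (α ⊕ α') (β ⊕ β')
        (Sum.elim (fun i => L i + mk α' β' L' R') (fun i => mk α β L R + L' i))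
        (Sum.elim (fun j => R j + mk α' β' L' R') (fun j => mk α β L R + R' j)) :=
  rfl

/-- The game `{ | }` without options. -/
def zero : Game := mk Empty Empty Empty.elim Empty.elim

instance : Zero Game := ⟨zero⟩

/-- The game `{G | H}` with one Left option `G` and one Right option `H`. -/
def ofOptions (G H : Game) : Game := mk Unit Unit (fun _ => G) (fun _ => H)

/-- `* = {0 | 0}` -/
def star : Game := ofOptions 0 0

/-- `↑ = {0 | *}` -/
def up : Game := ofOptions 0 star

/-- `↓ = {* | 0}` -/
def down : Game := ofOptions star 0

/-- `↑* = ↑ + *` -/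
def upStar : Game := up + star

/-- `↓* = ↓ + *` -/
def downStar : Game := down + star

/-- `G ≤ H` if `o(G + X) ≤ o(H + X)` for every game `X`. -/
instance : LE Game := ⟨fun G H => ∀ X : Game, outcome (G + X) ≤ outcome (H + X)⟩

instance : LT Game := ⟨fun G H => G ≤ H ∧ ¬ H ≤ G⟩

/-- Equality of games as values: `G ≡ H`. -/
def Equivalent (G H : Game) : Prop := G ≤ H ∧ H ≤ G

/-- `G` is fuzzy with (incomparable to) `H`. -/
def Fuzzy (G H : Game) : Prop := ¬ G ≤ H ∧ ¬ H ≤ G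

/-- `G` is less than or fuzzy with `H`. -/
def LessOrFuzzy (G H : Game) : Prop := G < H ∨ Fuzzy G H

end Game

end CGT

namespace Bipass

/-- The stones: Left plays the black ones, Right the white ones. -/
inductive Stone
  | black
  | white
  deriving DecidableEq

open Stone

/-- All stones of the row `s` are alive: every black stone has a white stone somewhere to its
right, and every white stone has a black stone somewhere to its left. -/
def AllAlive (s : List Stone) : Prop :=
  (∀ u v, s = u ++ black :: v → white ∈ v) ∧ (∀ u v, s = u ++ white :: v → black ∈ u)

/-- A strip, as a component of a sum: a non-empty row of stones all of which are alive. -/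
def IsStrip (s : List Stone) : Prop := s ≠ [] ∧ AllAlive s

/-- Removal of the dead stones: the white stones with no black stone to their left, and the black
stones with no white stone to their right. -/
def removeDead (s : List Stone) : List Stone :=
  (s.dropWhile (fun x => decide (x = white))).rdropWhile (fun x => decide (x = black))

/-- Left interchanges a black stone and a white stone to its right, with no black stone between
them; then the dead stones are removed: `LeftMove s t` says that `t` is a possible result. -/
def LeftMove (s t : List Stone) : Prop :=
  ∃ u m v, s = u ++ black :: (m ++ white :: v) ∧ black ∉ m ∧
    t = removeDead (u ++ white :: (m ++ black :: v))

/-- Right interchanges a black stone and a white stone to its right, with no white stone between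
them; then the dead stones are removed: `RightMove s t` says that `t` is a possible result. -/
def RightMove (s t : List Stone) : Prop :=
  ∃ u m v, s = u ++ black :: (m ++ white :: v) ∧ white ∉ m ∧
    t = removeDead (u ++ white :: (m ++ black :: v))

/-- The number of pairs consisting of a black stone and a white stone to its right. It drops with
every move, so that play on a strip terminates. -/
def inversions : List Stone → ℕ
  | [] => 0
  | black :: l => l.count white + inversions l
  | white :: l => inversions l

theorem inversions_append (u v : List Stone) :
    inversions (u ++ v) = inversions u + inversions v + u.count black * v.count white := by
  induction u with
  | nil => simp [inversions]
  | cons x u ih => cases x <;> (simp [inversions, ih]; try ring)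

theorem inversions_removeDead (s : List Stone) : inversions (removeDead s) = inversions s := by
  have h1 : ∀ l : List Stone,
      inversions (l.dropWhile (fun x => decide (x = white))) = inversions l := by
    intro l
    induction l with
    | nil => rfl
    | cons x l ih => cases x <;> simp [inversions, ih]
  have h2 : ∀ l : List Stone,
      inversions (l.rdropWhile (fun x => decide (x = black))) = inversions l := by
    intro l
    induction l using List.reverseRecOn with
    | nil => rfl
    | append_singleton l x ih =>
      cases x <;> simp [inversions_append, inversions, ih]
  rw [removeDead, h2, h1]

theorem inversions_swap_lt (u m v : List Stone) :
    inversions (removeDead (u ++ white :: (m ++ black :: v))) <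
      inversions (u ++ black :: (m ++ white :: v)) := by
  rw [inversions_removeDead]
  simp [inversions_append, inversions]
  ring_nf
  omega

/-- The game played on a single strip. -/
def stripGame (s : List Stone) : CGT.Game :=
  CGT.Game.mk {t // LeftMove s t} {t // RightMove s t}
    (fun t => stripGame t.1) (fun t => stripGame t.1)
termination_by inversions s
decreasing_by
  all_goals
    obtain ⟨u, m, v, rfl, -, ht⟩ := t.2
    rw [ht]
    exact inversions_swap_lt u m v

/-- The game played on several strips: the disjunctive sum of the games on the strips. -/
def sumGame (S : List (List Stone)) : CGT.Game := (S.map stripGame).sum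

/-- The excess `Δ(s)` of white stones over black stones on a strip. -/
def excess (s : List Stone) : ℤ := (s.count white : ℤ) - s.count black

/-- The excess `Δ(g)` of a sum of strips. -/
def totalExcess (S : List (List Stone)) : ℤ := (S.map excess).sum

/-- A larva: one black stone followed by at least one white stone (black headed), or at least one
black stone followed by one white stone (white headed). -/
def IsLarva (s : List Stone) : Prop :=
  ∃ k : ℕ, 1 ≤ k ∧ (s = black :: List.replicate k white ∨ s = List.replicate k black ++ [white])

end Bipass

open CGT Bipass

/-! The theorem reduces to sufficient conditions, in terms of the excess Δ and the number n of
strips, for Left to win a sum. Moving first she wins if Δ ≥ 1, or if Δ = 0 and n is odd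
(`FirstCriterion`). Moving second she wins if Δ ≥ 2, or if Δ = 1 and n is odd, or if n is even and
every strip is `[black, white]` (`SecondCriterion`).

A move by Right either leaves the strip in place and costs Left at most one unit of excess, or
clears the strip, which never lowers Δ (`RightMove.excess`). Hence Right can only pass from the
second criterion to the first (`secondCriterion_step`). Conversely, Left returns to the second
(`exists_move_of_firstCriterion`). If a strip has two black stones, she carries its last one to the
end, where it dies, gaining one unit and keeping n. Otherwise every strip is a single black stone
followed by white ones, and cases on Δ and the parity of n give a move.

The strips `[black, white]` and `[black, white, white]` have values `*` and `↑`. Adding `*`, `↑` or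
`↑*` to g therefore means adding strips: Δ changes by 0, 1, 1 and n by 1, 1, 2. All upper
comparisons become instances of the criteria. Reading rows backwards with colours interchanged
negates values and excess, which yields the lower comparisons.

Larvae with Δ = 0 and n even need a separate strategy for the second player, who keeps Δ = 0 with
the same n until the opponent allows the first criterion (`leftWins_sumGame_larvae`). -/

namespace CGT.Game

/-! ### Options and winning strategies. -/

/-- `K` is a Left option of `G`. -/
def IsLeftOption : Game → Game → Prop
  | mk _ _ L _, K => ∃ i, L i = K

/-- `K` is a Right option of `G`. -/
def IsRightOption : Game → Game → Prop
  | mk _ _ _ R, K => ∃ j, R j = K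

theorem leftWins_true_iff (G : Game) :
    LeftWins true G ↔ ∃ K, IsLeftOption G K ∧ LeftWins false K := by
  cases G with
  | mk α β L R => simp [LeftWins, IsLeftOption]

theorem leftWins_false_iff (G : Game) :
    LeftWins false G ↔ ∀ K, IsRightOption G K → LeftWins true K := by
  cases G with
  | mk α β L R => simp [LeftWins, IsRightOption]

theorem isLeftOption_add (G H K : Game) :
    IsLeftOption (G + H) K ↔
      (∃ G', IsLeftOption G G' ∧ K = G' + H) ∨ ∃ H', IsLeftOption H H' ∧ K = G + H' := by
  cases G with
  | mk α β L R =>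
    cases H with
    | mk α' β' L' R' => simp [add_mk_mk, IsLeftOption, eq_comm]

theorem isRightOption_add (G H K : Game) :
    IsRightOption (G + H) K ↔
      (∃ G', IsRightOption G G' ∧ K = G' + H) ∨ ∃ H', IsRightOption H H' ∧ K = G + H' := by
  cases G with
  | mk α β L R =>
    cases H with
    | mk α' β' L' R' => simp [add_mk_mk, IsRightOption, eq_comm]

theorem not_isLeftOption_zero (K : Game) : ¬ IsLeftOption 0 K := fun ⟨i, _⟩ => i.elim

theorem not_isRightOption_zero (K : Game) : ¬ IsRightOption 0 K := fun ⟨i, _⟩ => i.elim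

/-- Induction on the options of a game. -/
theorem optionInduction {P : Game → Prop}
    (h : ∀ G, (∀ K, IsLeftOption G K → P K) → (∀ K, IsRightOption G K → P K) → P G)
    (G : Game) : P G := by
  induction G with
  | mk α β L R ihL ihR =>
    refine h _ ?_ ?_
    · rintro K ⟨i, rfl⟩; exact ihL i
    · rintro K ⟨j, rfl⟩; exact ihR j

/-! ### Identical games and the laws of addition. -/

/-- Two games with the same options, up to repetition of options and recursively. -/
def Identical : Game → Game → Prop
  | mk _ _ L R, H =>
    ((∀ i, ∃ K, IsLeftOption H K ∧ Identical (L i) K) ∧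
      ∀ K, IsLeftOption H K → ∃ i, Identical (L i) K) ∧
    ((∀ j, ∃ K, IsRightOption H K ∧ Identical (R j) K) ∧
      ∀ K, IsRightOption H K → ∃ j, Identical (R j) K)

theorem identical_iff (G H : Game) :
    Identical G H ↔
      ((∀ G', IsLeftOption G G' → ∃ H', IsLeftOption H H' ∧ Identical G' H') ∧
        ∀ H', IsLeftOption H H' → ∃ G', IsLeftOption G G' ∧ Identical G' H') ∧
      ((∀ G', IsRightOption G G' → ∃ H', IsRightOption H H' ∧ Identical G' H') ∧
        ∀ H', IsRightOption H H' → ∃ G', IsRightOption G G' ∧ Identical G' H') := by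
  cases G with
  | mk α β L R => simp [Identical, IsLeftOption, IsRightOption]

theorem Identical.leftWins_iff {G H : Game} (h : Identical G H) (b : Bool) :
    LeftWins b G ↔ LeftWins b H := by
  induction G using optionInduction generalizing H b with
  | h G ihL ihR =>
    obtain ⟨⟨h1, h2⟩, h3, h4⟩ := (identical_iff _ _).1 h
    cases b
    · rw [leftWins_false_iff, leftWins_false_iff]
      constructor
      · intro hw K hK
        obtain ⟨G', hG', hi⟩ := h4 K hK
        exact (ihR G' hG' hi true).1 (hw G' hG')
      · intro hw K hK
        obtain ⟨H', hH', hi⟩ := h3 K hK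
        exact (ihR K hK hi true).2 (hw H' hH')
    · rw [leftWins_true_iff, leftWins_true_iff]
      constructor
      · rintro ⟨K, hK, hw⟩
        obtain ⟨H', hH', hi⟩ := h1 K hK
        exact ⟨H', hH', (ihL K hK hi false).1 hw⟩
      · rintro ⟨K, hK, hw⟩
        obtain ⟨G', hG', hi⟩ := h2 K hK
        exact ⟨G', hG', (ihL G' hG' hi false).2 hw⟩

theorem Identical.outcome_eq {G H : Game} (h : Identical G H) : outcome G = outcome H :=
  Prod.ext (propext (h.leftWins_iff true)) (propext (h.leftWins_iff false))

theorem Identical.add_right {G H : Game} (h : Identical G H) (X : Game) :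
    Identical (G + X) (H + X) := by
  induction G using optionInduction generalizing H X with
  | h G ihL ihR =>
    induction X using optionInduction with
    | h X jhL jhR =>
      obtain ⟨⟨h1, h2⟩, h3, h4⟩ := (identical_iff _ _).1 h
      rw [identical_iff]
      simp only [isLeftOption_add, isRightOption_add]
      refine ⟨⟨?_, ?_⟩, ?_, ?_⟩
      · rintro _ (⟨K, hK, rfl⟩ | ⟨K, hK, rfl⟩)
        · obtain ⟨H', hH', hi⟩ := h1 K hK
          exact ⟨_, .inl ⟨H', hH', rfl⟩, ihL K hK hi X⟩
        · exact ⟨_, .inr ⟨K, hK, rfl⟩, jhL K hK⟩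
      · rintro _ (⟨K, hK, rfl⟩ | ⟨K, hK, rfl⟩)
        · obtain ⟨G', hG', hi⟩ := h2 K hK
          exact ⟨_, .inl ⟨G', hG', rfl⟩, ihL G' hG' hi X⟩
        · exact ⟨_, .inr ⟨K, hK, rfl⟩, jhL K hK⟩
      · rintro _ (⟨K, hK, rfl⟩ | ⟨K, hK, rfl⟩)
        · obtain ⟨H', hH', hi⟩ := h3 K hK
          exact ⟨_, .inl ⟨H', hH', rfl⟩, ihR K hK hi X⟩
        · exact ⟨_, .inr ⟨K, hK, rfl⟩, jhR K hK⟩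
      · rintro _ (⟨K, hK, rfl⟩ | ⟨K, hK, rfl⟩)
        · obtain ⟨G', hG', hi⟩ := h4 K hK
          exact ⟨_, .inl ⟨G', hG', rfl⟩, ihR G' hG' hi X⟩
        · exact ⟨_, .inr ⟨K, hK, rfl⟩, jhR K hK⟩

theorem identical_add_comm (G H : Game) : Identical (G + H) (H + G) := by
  induction G using optionInduction generalizing H with
  | h G ihL ihR =>
    induction H using optionInduction with
    | h H jhL jhR =>
      rw [identical_iff]
      simp only [isLeftOption_add, isRightOption_add]
      refine ⟨⟨?_, ?_⟩, ?_, ?_⟩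
      · rintro _ (⟨K, hK, rfl⟩ | ⟨K, hK, rfl⟩)
        · exact ⟨_, .inr ⟨K, hK, rfl⟩, ihL K hK H⟩
        · exact ⟨_, .inl ⟨K, hK, rfl⟩, jhL K hK⟩
      · rintro _ (⟨K, hK, rfl⟩ | ⟨K, hK, rfl⟩)
        · exact ⟨_, .inr ⟨K, hK, rfl⟩, jhL K hK⟩
        · exact ⟨_, .inl ⟨K, hK, rfl⟩, ihL K hK H⟩
      · rintro _ (⟨K, hK, rfl⟩ | ⟨K, hK, rfl⟩)
        · exact ⟨_, .inr ⟨K, hK, rfl⟩, ihR K hK H⟩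
        · exact ⟨_, .inl ⟨K, hK, rfl⟩, jhR K hK⟩
      · rintro _ (⟨K, hK, rfl⟩ | ⟨K, hK, rfl⟩)
        · exact ⟨_, .inr ⟨K, hK, rfl⟩, jhR K hK⟩
        · exact ⟨_, .inl ⟨K, hK, rfl⟩, ihR K hK H⟩

theorem identical_add_assoc (G H X : Game) : Identical (G + H + X) (G + (H + X)) := by
  induction G using optionInduction generalizing H X with
  | h G ihL ihR =>
    induction H using optionInduction generalizing X with
    | h H jhL jhR =>
      induction X using optionInduction with
      | h X khL khR =>
        rw [identical_iff]
        simp only [isLeftOption_add, isRightOption_add]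
        refine ⟨⟨?_, ?_⟩, ?_, ?_⟩
        · rintro _ (⟨_, ⟨K, hK, rfl⟩ | ⟨K, hK, rfl⟩, rfl⟩ | ⟨K, hK, rfl⟩)
          · exact ⟨_, .inl ⟨K, hK, rfl⟩, ihL K hK H X⟩
          · exact ⟨_, .inr ⟨_, .inl ⟨K, hK, rfl⟩, rfl⟩, jhL K hK X⟩
          · exact ⟨_, .inr ⟨_, .inr ⟨K, hK, rfl⟩, rfl⟩, khL K hK⟩
        · rintro _ (⟨K, hK, rfl⟩ | ⟨_, ⟨K, hK, rfl⟩ | ⟨K, hK, rfl⟩, rfl⟩)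
          · exact ⟨_, .inl ⟨_, .inl ⟨K, hK, rfl⟩, rfl⟩, ihL K hK H X⟩
          · exact ⟨_, .inl ⟨_, .inr ⟨K, hK, rfl⟩, rfl⟩, jhL K hK X⟩
          · exact ⟨_, .inr ⟨K, hK, rfl⟩, khL K hK⟩
        · rintro _ (⟨_, ⟨K, hK, rfl⟩ | ⟨K, hK, rfl⟩, rfl⟩ | ⟨K, hK, rfl⟩)
          · exact ⟨_, .inl ⟨K, hK, rfl⟩, ihR K hK H X⟩
          · exact ⟨_, .inr ⟨_, .inl ⟨K, hK, rfl⟩, rfl⟩, jhR K hK X⟩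
          · exact ⟨_, .inr ⟨_, .inr ⟨K, hK, rfl⟩, rfl⟩, khR K hK⟩
        · rintro _ (⟨K, hK, rfl⟩ | ⟨_, ⟨K, hK, rfl⟩ | ⟨K, hK, rfl⟩, rfl⟩)
          · exact ⟨_, .inl ⟨_, .inl ⟨K, hK, rfl⟩, rfl⟩, ihR K hK H X⟩
          · exact ⟨_, .inl ⟨_, .inr ⟨K, hK, rfl⟩, rfl⟩, jhR K hK X⟩
          · exact ⟨_, .inr ⟨K, hK, rfl⟩, khR K hK⟩

theorem identical_zero_add (G : Game) : Identical (0 + G) G := by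
  induction G using optionInduction with
  | h G ihL ihR =>
    rw [identical_iff]
    simp only [isLeftOption_add, isRightOption_add]
    refine ⟨⟨?_, ?_⟩, ?_, ?_⟩
    · rintro _ (⟨K, hK, rfl⟩ | ⟨K, hK, rfl⟩)
      · exact (not_isLeftOption_zero K hK).elim
      · exact ⟨K, hK, ihL K hK⟩
    · exact fun K hK => ⟨_, .inr ⟨K, hK, rfl⟩, ihL K hK⟩
    · rintro _ (⟨K, hK, rfl⟩ | ⟨K, hK, rfl⟩)
      · exact (not_isRightOption_zero K hK).elim
      · exact ⟨K, hK, ihR K hK⟩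
    · exact fun K hK => ⟨_, .inr ⟨K, hK, rfl⟩, ihR K hK⟩

/-- Left answers each move of Right in the component where it was made. Replies to Right's moves
alternate between the components, so the induction needs both versions in which Left starts. -/
theorem leftWins_add {G H : Game} {b : Bool} (hG : LeftWins false G) (hH : LeftWins b H) :
    LeftWins b (G + H) := by
  suffices ∀ G H : Game,
      (LeftWins false G → LeftWins false H → LeftWins false (G + H)) ∧
      (LeftWins false G → LeftWins true H → LeftWins true (G + H)) ∧
      (LeftWins true G → LeftWins false H → LeftWins true (G + H)) by
    cases b
    · exact (this G H).1 hG hH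
    · exact (this G H).2.1 hG hH
  intro G
  induction G using optionInduction with
  | h G ihL ihR =>
    intro H
    induction H using optionInduction with
    | h H jhL jhR =>
      refine ⟨fun hG hH => ?_, fun hG hH => ?_, fun hG hH => ?_⟩
      · rw [leftWins_false_iff]
        simp only [isRightOption_add]
        rintro _ (⟨K, hK, rfl⟩ | ⟨K, hK, rfl⟩)
        · exact (ihR K hK H).2.2 ((leftWins_false_iff G).1 hG K hK) hH
        · exact (jhR K hK).2.1 hG ((leftWins_false_iff H).1 hH K hK)
      · obtain ⟨K, hK, hw⟩ := (leftWins_true_iff H).1 hH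
        exact (leftWins_true_iff _).2
          ⟨_, (isLeftOption_add _ _ _).2 (.inr ⟨K, hK, rfl⟩), (jhL K hK).1 hG hw⟩
      · obtain ⟨K, hK, hw⟩ := (leftWins_true_iff G).1 hG
        exact (leftWins_true_iff _).2
          ⟨_, (isLeftOption_add _ _ _).2 (.inl ⟨K, hK, rfl⟩), (ihL K hK H).1 hw hH⟩

/-! ### Negatives. -/

/-- The game with the roles of the players interchanged. -/
def neg : Game → Game
  | mk α β L R => mk β α (fun j => neg (R j)) (fun i => neg (L i))

instance : Neg Game := ⟨neg⟩

theorem neg_mk {α β : Type} (L : α → Game) (R : β → Game) :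
    -mk α β L R = mk β α (fun j => -R j) (fun i => -L i) := rfl

theorem isLeftOption_neg (G K : Game) :
    IsLeftOption (-G) K ↔ ∃ K', IsRightOption G K' ∧ K = -K' := by
  cases G with
  | mk α β L R => simp [neg_mk, IsLeftOption, IsRightOption, eq_comm]

theorem isRightOption_neg (G K : Game) :
    IsRightOption (-G) K ↔ ∃ K', IsLeftOption G K' ∧ K = -K' := by
  cases G with
  | mk α β L R => simp [neg_mk, IsLeftOption, IsRightOption, eq_comm]

/-- Left plays Right's part of `G`, and since finite games are determined, Right wins exactly when
Left does not. -/
theorem leftWins_neg (b : Bool) (G : Game) : LeftWins b (-G) ↔ ¬ LeftWins (!b) G := by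
  induction G using optionInduction generalizing b with
  | h G ihL ihR =>
    cases b
    · rw [leftWins_false_iff, Bool.not_false, leftWins_true_iff]
      simp only [isRightOption_neg]
      push Not
      constructor
      · intro h K hK
        exact (ihL K hK true).1 (h _ ⟨K, hK, rfl⟩)
      · rintro h _ ⟨K, hK, rfl⟩
        exact (ihL K hK true).2 (h K hK)
    · rw [leftWins_true_iff, Bool.not_true, leftWins_false_iff]
      simp only [isLeftOption_neg]
      push Not
      constructor
      · rintro ⟨_, ⟨K, hK, rfl⟩, h⟩
        exact ⟨K, hK, (ihR K hK false).1 h⟩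
      · rintro ⟨K, hK, h⟩
        exact ⟨_, ⟨K, hK, rfl⟩, (ihR K hK false).2 h⟩

theorem neg_add_eq (G H : Game) : -(G + H) = -G + -H := by
  induction G generalizing H with
  | mk α β L R ihL ihR =>
    induction H with
    | mk α' β' L' R' jhL jhR =>
      rw [add_mk_mk, neg_mk, neg_mk, neg_mk, add_mk_mk]
      congr 1
      · funext j
        rcases j with j | j
        · exact ihR j _
        · exact jhR j
      · funext i
        rcases i with i | i
        · exact ihL i _
        · exact jhL i

theorem neg_neg_eq (G : Game) : - -G = G := by
  induction G with
  | mk α β L R ihL ihR =>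
    rw [neg_mk, neg_mk]
    congr 1
    · exact funext ihL
    · exact funext ihR

/-- The mirror strategy: every move of Right in one component has its negative available to Left in
the other. -/
theorem leftWins_false_add_neg (G : Game) : LeftWins false (G + -G) := by
  induction G using optionInduction with
  | h G ihL ihR =>
    rw [leftWins_false_iff]
    simp only [isRightOption_add, isRightOption_neg]
    rintro _ (⟨K, hK, rfl⟩ | ⟨_, ⟨K, hK, rfl⟩, rfl⟩)
    · exact (leftWins_true_iff _).2 ⟨_, (isLeftOption_add _ _ _).2
        (.inr ⟨_, (isLeftOption_neg _ _).2 ⟨K, hK, rfl⟩, rfl⟩), ihR K hK⟩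
    · exact (leftWins_true_iff _).2 ⟨_, (isLeftOption_add _ _ _).2
        (.inl ⟨K, hK, rfl⟩), ihL K hK⟩

/-! ### The order, and comparison with zero by play. -/

instance : Preorder Game where
  le_refl _ _ := le_rfl
  le_trans _ _ _ h1 h2 X := (h1 X).trans (h2 X)
  lt_iff_le_not_ge _ _ := Iff.rfl

theorem Identical.le {G H : Game} (h : Identical G H) : G ≤ H :=
  fun X => (h.add_right X).outcome_eq.le

theorem Identical.ge {G H : Game} (h : Identical G H) : H ≤ G :=
  fun X => (h.add_right X).outcome_eq.ge

theorem Identical.equivalent {G H : Game} (h : Identical G H) : Equivalent G H := ⟨h.le, h.ge⟩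

theorem add_le_add_of_le_right {G H : Game} (h : G ≤ H) (X : Game) : G + X ≤ H + X := by
  intro Y
  rw [(identical_add_assoc G X Y).outcome_eq, (identical_add_assoc H X Y).outcome_eq]
  exact h _

theorem add_le_add_of_le_left {G H : Game} (h : G ≤ H) (X : Game) : X + G ≤ X + H :=
  ((identical_add_comm X G).le.trans (add_le_add_of_le_right h X)).trans
    (identical_add_comm H X).le

theorem leftWins_false_zero : LeftWins false 0 :=
  (leftWins_false_iff _).2 fun K hK => (not_isRightOption_zero K hK).elim

theorem not_leftWins_true_zero : ¬ LeftWins true 0 := fun h =>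
  let ⟨K, hK, _⟩ := (leftWins_true_iff _).1 h
  not_isLeftOption_zero K hK

theorem leftWins_mono {G H : Game} (h : G ≤ H) {b : Bool} (hG : LeftWins b G) : LeftWins b H := by
  have h0 : ∀ K : Game, outcome (K + 0) = outcome K := fun K => by
    rw [(identical_add_comm K 0).outcome_eq, (identical_zero_add K).outcome_eq]
  have h1 := h 0
  rw [h0, h0] at h1
  cases b
  · exact h1.2 hG
  · exact h1.1 hG

theorem zero_le_iff (G : Game) : 0 ≤ G ↔ LeftWins false G := by
  refine ⟨fun h => leftWins_mono h leftWins_false_zero, fun h X => ?_⟩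
  rw [(identical_zero_add X).outcome_eq]
  exact ⟨fun hX => leftWins_add h hX, fun hX => leftWins_add h hX⟩

theorem le_zero_iff (G : Game) : G ≤ 0 ↔ ¬ LeftWins true G := by
  refine ⟨fun h hG => not_leftWins_true_zero (leftWins_mono h hG), fun h X => ?_⟩
  rw [(identical_zero_add X).outcome_eq]
  have hn : LeftWins false (-G) := (leftWins_neg _ _).2 h
  -- If Left lost `X`, she would win `-X` with the other player starting, hence also `-G + -X`, and
  -- so lose `G + X`.
  have key : ∀ b, LeftWins b (G + X) → LeftWins b X := fun b hb => by
    by_contra hX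
    have hX' : LeftWins (!b) (-X) := by rwa [leftWins_neg, Bool.not_not]
    have h2 := leftWins_add hn hX'
    rw [← neg_add_eq, leftWins_neg, Bool.not_not] at h2
    exact h2 hb
  exact ⟨key true, key false⟩

theorem equivalent_add_neg (G : Game) : Equivalent (G + -G) 0 := by
  refine ⟨?_, (zero_le_iff _).2 (leftWins_false_add_neg G)⟩
  rw [le_zero_iff]
  have h : LeftWins false (-(G + -G)) := by
    rw [neg_add_eq, neg_neg_eq, (identical_add_comm _ _).leftWins_iff]
    exact leftWins_false_add_neg G
  exact (leftWins_neg false _).1 h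

/-! ### The ordered abelian group of values. -/

/-- The values of games: games up to equivalence. -/
abbrev Value : Type 1 := Antisymmetrization Game (· ≤ ·)

/-- The value of a game. -/
def value (G : Game) : Value := toAntisymmetrization (· ≤ ·) G

theorem value_le_iff {G H : Game} : value G ≤ value H ↔ G ≤ H := Iff.rfl

theorem value_lt_iff {G H : Game} : value G < value H ↔ G < H := Iff.rfl

theorem value_eq_iff {G H : Game} : value G = value H ↔ Equivalent G H := Quotient.eq

instance : Add Value :=
  ⟨Quotient.map₂ (· + ·) fun _ _ h _ _ h' =>
    ⟨(add_le_add_of_le_right h.1 _).trans (add_le_add_of_le_left h'.1 _),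
      (add_le_add_of_le_right h.2 _).trans (add_le_add_of_le_left h'.2 _)⟩⟩

instance : Zero Value := ⟨value 0⟩

theorem value_add (G H : Game) : value (G + H) = value G + value H := rfl

theorem value_zero : value 0 = 0 := rfl

theorem value_surjective (x : Value) : ∃ G, value G = x := Quotient.exists_rep x

/-- Uniqueness of inverses in a commutative monoid, argued by hand because negation has to respect
equivalence before values can form a group. -/
theorem equivalent_neg {G H : Game} (h : Equivalent G H) : Equivalent (-G) (-H) := by
  have cancel : ∀ A B : Game, value A + value B + value (-B) = value A := fun A B => by
    rw [← value_add, ← value_add, value_eq_iff]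
    have h1 := (value_eq_iff.2 (identical_add_assoc A B (-B)).equivalent).trans
      (congrArg (value A + ·) (value_eq_iff.2 (equivalent_add_neg B)))
    exact value_eq_iff.1 (h1.trans
      ((value_eq_iff.2 (identical_add_comm A 0).equivalent).trans
        (value_eq_iff.2 (identical_zero_add A).equivalent)))
  have comm : ∀ A B : Game, value A + value B = value B + value A := fun A B =>
    value_eq_iff.2 (identical_add_comm A B).equivalent
  have e := value_eq_iff.2 h
  rw [← value_eq_iff]
  calc value (-G) = value (-G) + value (-H) + value H := by
        simpa only [neg_neg_eq] using (cancel (-G) (-H)).symm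
    _ = value (-H) + value (-G) + value G := by rw [comm (-G), e]
    _ = value (-H) := by
        simpa only [neg_neg_eq] using cancel (-H) (-G)

instance : Neg Value := ⟨Quotient.map (- ·) fun _ _ h => equivalent_neg h⟩

instance : AddCommGroup Value where
  add_assoc x y z := by
    obtain ⟨G, rfl⟩ := value_surjective x
    obtain ⟨H, rfl⟩ := value_surjective y
    obtain ⟨K, rfl⟩ := value_surjective z
    exact value_eq_iff.2 (identical_add_assoc G H K).equivalent
  zero_add x := by
    obtain ⟨G, rfl⟩ := value_surjective x
    exact value_eq_iff.2 (identical_zero_add G).equivalent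
  add_zero x := by
    obtain ⟨G, rfl⟩ := value_surjective x
    exact (value_eq_iff.2 (identical_add_comm G 0).equivalent).trans
      (value_eq_iff.2 (identical_zero_add G).equivalent)
  add_comm x y := by
    obtain ⟨G, rfl⟩ := value_surjective x
    obtain ⟨H, rfl⟩ := value_surjective y
    exact value_eq_iff.2 (identical_add_comm G H).equivalent
  neg_add_cancel x := by
    obtain ⟨G, rfl⟩ := value_surjective x
    exact (value_eq_iff.2 (identical_add_comm (-G) G).equivalent).trans
      (value_eq_iff.2 (equivalent_add_neg G))
  nsmul := nsmulRec
  zsmul := zsmulRec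

theorem value_neg (G : Game) : value (-G) = -value G := rfl

instance : IsOrderedAddMonoid Value where
  add_le_add_left x y h z := by
    obtain ⟨G, rfl⟩ := value_surjective x
    obtain ⟨H, rfl⟩ := value_surjective y
    obtain ⟨K, rfl⟩ := value_surjective z
    exact add_le_add_of_le_right (value_le_iff.1 h) K

theorem fuzzy_iff (G H : Game) :
    Fuzzy G H ↔ ¬ value G ≤ value H ∧ ¬ value H ≤ value G := Iff.rfl

theorem lessOrFuzzy_iff (G H : Game) : LessOrFuzzy G H ↔ ¬ value H ≤ value G := by
  change (G ≤ H ∧ ¬ H ≤ G) ∨ (¬ G ≤ H ∧ ¬ H ≤ G) ↔ ¬ H ≤ G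
  tauto

/-- `G ≤ H` says that Left wins `H - G` moving second, and Right's opening moves there are his moves
in `H` and the negatives of Left's moves in `G`. This allows small games to be compared without
quantifying over all contexts. -/
theorem le_iff_options (G H : Game) :
    G ≤ H ↔ (∀ K, IsLeftOption G K → ¬ H ≤ K) ∧ ∀ K, IsRightOption H K → ¬ K ≤ G := by
  have key : ∀ A B : Game, LeftWins true (A + -B) ↔ ¬ A ≤ B := fun A B => by
    rw [← not_iff_not, ← le_zero_iff, not_not, ← value_le_iff, ← value_le_iff, value_add,
      value_neg, value_zero, add_neg_le_iff_le_add, zero_add]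
  have h : G ≤ H ↔ LeftWins false (H + -G) := by
    rw [← zero_le_iff, ← value_le_iff, ← value_le_iff, value_add, value_neg, value_zero,
      le_add_neg_iff_add_le, zero_add]
  rw [h, leftWins_false_iff]
  simp only [isRightOption_add, isRightOption_neg]
  constructor
  · intro h
    exact ⟨fun K hK => (key _ _).1 (h _ (.inr ⟨_, ⟨K, hK, rfl⟩, rfl⟩)),
      fun K hK => (key _ _).1 (h _ (.inl ⟨K, hK, rfl⟩))⟩
  · rintro ⟨h1, h2⟩ _ (⟨K, hK, rfl⟩ | ⟨_, ⟨K, hK, rfl⟩, rfl⟩)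
    · exact (key _ _).2 (h2 K hK)
    · exact (key _ _).2 (h1 K hK)

theorem neg_zero_eq : -(0 : Game) = 0 := by
  change mk Empty Empty _ _ = mk Empty Empty _ _
  congr 1 <;> exact funext fun i => i.elim

theorem neg_ofOptions (G H : Game) : -ofOptions G H = ofOptions (-H) (-G) := rfl

theorem neg_star : -star = star := by
  rw [star, neg_ofOptions, neg_zero_eq]

theorem neg_up : -up = down := by
  rw [up, neg_ofOptions, neg_zero_eq, neg_star, down]

theorem isLeftOption_ofOptions (G H K : Game) : IsLeftOption (ofOptions G H) K ↔ K = G := by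
  simp [ofOptions, IsLeftOption, eq_comm]

theorem isRightOption_ofOptions (G H K : Game) : IsRightOption (ofOptions G H) K ↔ K = H := by
  simp [ofOptions, IsRightOption, eq_comm]

theorem value_star_add_self : value star + value star = 0 := by
  nth_rw 1 [← neg_star]
  rw [value_neg, neg_add_cancel]

end CGT.Game

namespace Bipass

open CGT CGT.Game Stone

/-! The options of strips and of sums of strips -/

theorem isLeftOption_stripGame (s : List Stone) (K : Game) :
    IsLeftOption (stripGame s) K ↔ ∃ t, LeftMove s t ∧ K = stripGame t := by
  rw [stripGame]
  simp [IsLeftOption, eq_comm]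

theorem isRightOption_stripGame (s : List Stone) (K : Game) :
    IsRightOption (stripGame s) K ↔ ∃ t, RightMove s t ∧ K = stripGame t := by
  rw [stripGame]
  simp [IsRightOption, eq_comm]

theorem sumGame_cons (s : List Stone) (S : List (List Stone)) :
    sumGame (s :: S) = stripGame s + sumGame S := rfl

theorem isLeftOption_sumGame (S : List (List Stone)) (K : Game) :
    IsLeftOption (sumGame S) K ↔
      ∃ A s B t, S = A ++ s :: B ∧ LeftMove s t ∧ K = sumGame (A ++ t :: B) := by
  induction S generalizing K with
  | nil =>
    refine iff_of_false (not_isLeftOption_zero K) ?_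
    simp
  | cons x S ih =>
    rw [sumGame_cons, isLeftOption_add]
    simp only [isLeftOption_stripGame, ih]
    constructor
    · rintro (⟨_, ⟨t, ht, rfl⟩, rfl⟩ | ⟨_, ⟨A, s, B, t, rfl, ht, rfl⟩, rfl⟩)
      · exact ⟨[], x, S, t, rfl, ht, rfl⟩
      · exact ⟨x :: A, s, B, t, rfl, ht, rfl⟩
    · rintro ⟨A, s, B, t, hS, ht, rfl⟩
      rcases A with _ | ⟨a, A⟩
      · obtain ⟨rfl, rfl⟩ := List.cons.inj hS
        exact .inl ⟨_, ⟨t, ht, rfl⟩, rfl⟩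
      · obtain ⟨rfl, rfl⟩ := List.cons.inj hS
        exact .inr ⟨_, ⟨A, s, B, t, rfl, ht, rfl⟩, rfl⟩

theorem isRightOption_sumGame (S : List (List Stone)) (K : Game) :
    IsRightOption (sumGame S) K ↔
      ∃ A s B t, S = A ++ s :: B ∧ RightMove s t ∧ K = sumGame (A ++ t :: B) := by
  induction S generalizing K with
  | nil =>
    refine iff_of_false (not_isRightOption_zero K) ?_
    simp
  | cons x S ih =>
    rw [sumGame_cons, isRightOption_add]
    simp only [isRightOption_stripGame, ih]
    constructor
    · rintro (⟨_, ⟨t, ht, rfl⟩, rfl⟩ | ⟨_, ⟨A, s, B, t, rfl, ht, rfl⟩, rfl⟩)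
      · exact ⟨[], x, S, t, rfl, ht, rfl⟩
      · exact ⟨x :: A, s, B, t, rfl, ht, rfl⟩
    · rintro ⟨A, s, B, t, hS, ht, rfl⟩
      rcases A with _ | ⟨a, A⟩
      · obtain ⟨rfl, rfl⟩ := List.cons.inj hS
        exact .inl ⟨_, ⟨t, ht, rfl⟩, rfl⟩
      · obtain ⟨rfl, rfl⟩ := List.cons.inj hS
        exact .inr ⟨_, ⟨A, s, B, t, rfl, ht, rfl⟩, rfl⟩

/-! Reversing a row and interchanging the colours -/

/-- The other colour. -/
def Stone.swap : Stone → Stone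
  | black => white
  | white => black

theorem Stone.swap_swap (x : Stone) : x.swap.swap = x := by cases x <;> rfl

/-- The row read backwards with the colours interchanged. -/
def conj (s : List Stone) : List Stone := (s.map Stone.swap).reverse

@[simp]
theorem conj_nil : conj [] = [] := rfl

theorem conj_append (s t : List Stone) : conj (s ++ t) = conj t ++ conj s := by simp [conj]

theorem conj_cons (x : Stone) (t : List Stone) : conj (x :: t) = conj t ++ [x.swap] := by
  simp [conj]

theorem conj_conj (s : List Stone) : conj (conj s) = s := by
  simp [conj, Function.comp_def, Stone.swap_swap]

theorem conj_eq_nil (s : List Stone) : conj s = [] ↔ s = [] := by simp [conj]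

theorem mem_conj (x : Stone) (s : List Stone) : x ∈ conj s ↔ x.swap ∈ s := by
  simp only [conj, List.mem_reverse, List.mem_map]
  constructor
  · rintro ⟨y, hy, rfl⟩
    rwa [Stone.swap_swap]
  · exact fun h => ⟨_, h, Stone.swap_swap x⟩

theorem count_conj (x : Stone) (s : List Stone) : (conj s).count x = s.count x.swap := by
  induction s with
  | nil => rfl
  | cons y s ih => cases x <;> cases y <;> simp [conj_cons, Stone.swap] at ih ⊢ <;> omega

theorem excess_conj (s : List Stone) : excess (conj s) = -excess s := by
  simp [excess, count_conj, Stone.swap]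

theorem dropWhile_white_conj (s : List Stone) :
    (conj s).dropWhile (fun x => decide (x = white)) =
      conj (s.rdropWhile (fun x => decide (x = black))) := by
  induction s using List.reverseRecOn with
  | nil => rfl
  | append_singleton s x ih => cases x <;> simp [conj_append, conj_cons, Stone.swap, ih]

theorem rdropWhile_black_conj (s : List Stone) :
    (conj s).rdropWhile (fun x => decide (x = black)) =
      conj (s.dropWhile (fun x => decide (x = white))) := by
  induction s with
  | nil => rfl
  | cons x s ih => cases x <;> simp [conj_cons, Stone.swap, ih]

/-- Reading a row backwards with colours interchanged exchanges the two trimmings that make up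
`removeDead`, so their order must be immaterial. -/
theorem dropWhile_rdropWhile_comm (s : List Stone) :
    (s.rdropWhile (fun x => decide (x = black))).dropWhile (fun x => decide (x = white)) =
      (s.dropWhile (fun x => decide (x = white))).rdropWhile (fun x => decide (x = black)) := by
  induction s using List.reverseRecOn with
  | nil => rfl
  | append_singleton s x ih =>
    cases x
    · rw [List.rdropWhile_concat_pos _ _ _ (by simp), ih, List.dropWhile_append]
      split_ifs with h
      · simp [List.isEmpty_iff.1 h]
      · rw [List.rdropWhile_concat_pos _ _ _ (by simp)]
    · rw [List.rdropWhile_concat_neg _ _ _ (by simp), List.dropWhile_append]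
      split_ifs with h
      · simp
      · rw [List.rdropWhile_concat_neg _ _ _ (by simp)]

theorem removeDead_conj (s : List Stone) : removeDead (conj s) = conj (removeDead s) := by
  rw [removeDead, dropWhile_white_conj, rdropWhile_black_conj, dropWhile_rdropWhile_comm,
    removeDead]

/-- A black stone left of a white one remains such a pair under the reflection; only the colour
forbidden between them changes, which turns Left's rule into Right's. -/
theorem LeftMove.conj {s t : List Stone} (h : LeftMove s t) :
    RightMove (conj s) (conj t) := by
  obtain ⟨u, m, v, rfl, hm, rfl⟩ := h
  refine ⟨Bipass.conj v, Bipass.conj m, Bipass.conj u, ?_, ?_, ?_⟩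
  · simp [conj_append, conj_cons, Stone.swap]
  · simpa [mem_conj, Stone.swap] using hm
  · rw [← removeDead_conj]
    simp [conj_append, conj_cons, Stone.swap]

theorem RightMove.conj {s t : List Stone} (h : RightMove s t) :
    LeftMove (conj s) (conj t) := by
  obtain ⟨u, m, v, rfl, hm, rfl⟩ := h
  refine ⟨Bipass.conj v, Bipass.conj m, Bipass.conj u, ?_, ?_, ?_⟩
  · simp [conj_append, conj_cons, Stone.swap]
  · simpa [mem_conj, Stone.swap] using hm
  · rw [← removeDead_conj]
    simp [conj_append, conj_cons, Stone.swap]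

theorem LeftMove.inversions_lt {s t : List Stone} (h : LeftMove s t) :
    inversions t < inversions s := by
  obtain ⟨u, m, v, rfl, -, rfl⟩ := h
  exact inversions_swap_lt u m v

theorem RightMove.inversions_lt {s t : List Stone} (h : RightMove s t) :
    inversions t < inversions s := by
  obtain ⟨u, m, v, rfl, -, rfl⟩ := h
  exact inversions_swap_lt u m v

theorem identical_stripGame_conj (s : List Stone) :
    Identical (stripGame (conj s)) (-stripGame s) := by
  induction hn : inversions s using Nat.strong_induction_on generalizing s with
  | _ n ih =>
    subst hn
    rw [identical_iff]
    simp only [isLeftOption_neg, isRightOption_neg, isLeftOption_stripGame,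
      isRightOption_stripGame]
    refine ⟨⟨?_, ?_⟩, ?_, ?_⟩
    · rintro _ ⟨t, ht, rfl⟩
      have h := ht.conj
      rw [conj_conj] at h
      refine ⟨_, ⟨_, ⟨_, h, rfl⟩, rfl⟩, ?_⟩
      simpa only [conj_conj] using ih _ h.inversions_lt _ rfl
    · rintro _ ⟨_, ⟨t, ht, rfl⟩, rfl⟩
      exact ⟨_, ⟨_, ht.conj, rfl⟩, ih _ ht.inversions_lt _ rfl⟩
    · rintro _ ⟨t, ht, rfl⟩
      have h := ht.conj
      rw [conj_conj] at h
      refine ⟨_, ⟨_, ⟨_, h, rfl⟩, rfl⟩, ?_⟩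
      simpa only [conj_conj] using ih _ h.inversions_lt _ rfl
    · rintro _ ⟨_, ⟨t, ht, rfl⟩, rfl⟩
      exact ⟨_, ⟨_, ht.conj, rfl⟩, ih _ ht.inversions_lt _ rfl⟩

theorem value_stripGame_conj (s : List Stone) :
    value (stripGame (conj s)) = -value (stripGame s) :=
  value_eq_iff.2 (identical_stripGame_conj s).equivalent

theorem value_sumGame_cons (s : List Stone) (S : List (List Stone)) :
    value (sumGame (s :: S)) = value (stripGame s) + value (sumGame S) := rfl

theorem value_sumGame_nil : value (sumGame []) = 0 := rfl

theorem value_sumGame_map_conj (S : List (List Stone)) :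
    value (sumGame (S.map conj)) = -value (sumGame S) := by
  induction S with
  | nil => rw [List.map_nil, value_sumGame_nil, neg_zero]
  | cons s S ih =>
    rw [List.map_cons, value_sumGame_cons, value_sumGame_cons, ih, value_stripGame_conj, neg_add]

theorem totalExcess_map_conj (S : List (List Stone)) :
    totalExcess (S.map conj) = -totalExcess S := by
  induction S with
  | nil => rfl
  | cons s S ih =>
    simp only [totalExcess, List.map_cons, List.sum_cons, excess_conj] at ih ⊢
    omega

/-! Rows without dead stones -/

/-- A row that is empty or a strip: it is empty, or begins with a black stone and ends with a
white one. -/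
def IsRow (s : List Stone) : Prop := s = [] ∨ ∃ m, s = black :: (m ++ [white])

theorem IsStrip.exists_eq {s : List Stone} (h : IsStrip s) :
    ∃ m, s = black :: (m ++ [white]) := by
  obtain ⟨h0, h1, h2⟩ := h
  rcases s with _ | ⟨x, s⟩
  · exact (h0 rfl).elim
  · cases x
    · rcases List.eq_nil_or_concat' s with rfl | ⟨m, y, rfl⟩
      · simpa using h1 [] [] rfl
      · cases y
        · simpa using h1 (black :: m) [] (by simp)
        · exact ⟨m, rfl⟩
    · simpa using h2 [] s rfl

theorem IsRow.conj {s : List Stone} (h : IsRow s) : IsRow (conj s) := by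
  rcases h with rfl | ⟨m, rfl⟩
  · exact .inl rfl
  · exact .inr ⟨Bipass.conj m, by simp [conj_append, conj_cons, Stone.swap]⟩

theorem eq_replicate_white {m : List Stone} (h : black ∉ m) :
    m = List.replicate m.length white := by
  refine List.eq_replicate_iff.2 ⟨rfl, fun x hx => ?_⟩
  cases x
  · exact (h hx).elim
  · rfl

theorem eq_replicate_black {m : List Stone} (h : white ∉ m) :
    m = List.replicate m.length black := by
  refine List.eq_replicate_iff.2 ⟨rfl, fun x hx => ?_⟩
  cases x
  · rfl
  · exact (h hx).elim

/-! ### Effect of removing dead stones on rows and excess. -/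

theorem removeDead_white_cons (s : List Stone) : removeDead (white :: s) = removeDead s := by
  simp [removeDead]

theorem removeDead_replicate_white_append (k : ℕ) (s : List Stone) :
    removeDead (List.replicate k white ++ s) = removeDead s := by
  induction k with
  | zero => rfl
  | succ k ih => rw [List.replicate_succ, List.cons_append, removeDead_white_cons, ih]

theorem removeDead_append_black (s : List Stone) : removeDead (s ++ [black]) = removeDead s := by
  rw [removeDead, ← dropWhile_rdropWhile_comm, List.rdropWhile_concat_pos _ _ _ (by simp),
    dropWhile_rdropWhile_comm, removeDead]

theorem removeDead_append_replicate_black (s : List Stone) (k : ℕ) :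
    removeDead (s ++ List.replicate k black) = removeDead s := by
  induction k with
  | zero => simp
  | succ k ih => rw [List.replicate_succ', ← List.append_assoc, removeDead_append_black, ih]

theorem removeDead_strip (m : List Stone) :
    removeDead (black :: (m ++ [white])) = black :: (m ++ [white]) := by
  rw [removeDead, List.dropWhile_cons_of_neg (by simp), ← List.cons_append,
    List.rdropWhile_concat_neg _ _ _ (by simp)]

theorem removeDead_nil : removeDead [] = [] := rfl

theorem isRow_removeDead (s : List Stone) : IsRow (removeDead s) := by
  induction s with
  | nil => exact .inl rfl
  | cons x s ih =>
    cases x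
    · induction s using List.reverseRecOn with
      | nil => exact .inl rfl
      | append_singleton s y jh =>
        cases y
        · rw [← List.cons_append, removeDead_append_black]
          exact jh (by rwa [removeDead_append_black] at ih)
        · rw [removeDead_strip]
          exact .inr ⟨s, rfl⟩
    · rwa [removeDead_white_cons]

/-- After a black stone only trailing black stones can die. -/
theorem exists_removeDead_black_cons (s : List Stone) :
    ∃ k, black :: s = removeDead (black :: s) ++ List.replicate k black := by
  induction s using List.reverseRecOn with
  | nil => exact ⟨1, rfl⟩
  | append_singleton s x ih =>
    cases x
    · obtain ⟨k, hk⟩ := ih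
      refine ⟨k + 1, ?_⟩
      rw [← List.cons_append, removeDead_append_black, List.replicate_succ', ← List.append_assoc,
        ← hk]
    · exact ⟨0, by rw [removeDead_strip]; simp⟩

theorem excess_append (s t : List Stone) : excess (s ++ t) = excess s + excess t := by
  simp [excess]; ring

theorem excess_replicate_black (k : ℕ) : excess (List.replicate k black) = -k := by
  simp [excess, List.count_replicate]

theorem excess_replicate_white (k : ℕ) : excess (List.replicate k white) = k := by
  simp [excess, List.count_replicate]

theorem excess_black_cons (s : List Stone) : excess (black :: s) = excess s - 1 := by
  simp [excess]; ring

theorem excess_white_cons (s : List Stone) : excess (white :: s) = excess s + 1 := by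
  simp [excess]; ring

theorem excess_nil : excess [] = 0 := rfl

theorem excess_le_excess_removeDead_black_cons (s : List Stone) :
    excess (black :: s) ≤ excess (removeDead (black :: s)) := by
  obtain ⟨k, hk⟩ := exists_removeDead_black_cons s
  rw [hk, excess_append, excess_replicate_black, ← hk]
  omega

theorem removeDead_black_cons_ne_nil {s : List Stone} (h : white ∈ s) :
    removeDead (black :: s) ≠ [] := by
  intro h0
  obtain ⟨k, hk⟩ := exists_removeDead_black_cons s
  rw [h0, List.nil_append] at hk
  have : white ∈ List.replicate k black := hk ▸ List.mem_cons_of_mem _ h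
  simp at this

theorem RightMove.isRow {s t : List Stone} (h : RightMove s t) : IsRow t := by
  obtain ⟨u, m, v, -, -, rfl⟩ := h
  exact isRow_removeDead _

theorem LeftMove.isRow {s t : List Stone} (h : LeftMove s t) : IsRow t := by
  obtain ⟨u, m, v, -, -, rfl⟩ := h
  exact isRow_removeDead _

theorem RightMove.ne_nil {s t : List Stone} (h : RightMove s t) : s ≠ [] := by
  obtain ⟨u, m, v, rfl, -, -⟩ := h
  simp

/-- A move by Right that leaves stones on the row lowers the excess by at most one. A move that
clears the row requires a nonpositive excess. -/
theorem RightMove.excess {s t : List Stone} (hs : IsRow s) (h : RightMove s t) :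
    (t ≠ [] ∧ excess s - 1 ≤ excess t) ∨ (t = [] ∧ excess s ≤ 0) := by
  have hs0 := h.ne_nil
  obtain ⟨u, m, v, rfl, hm, rfl⟩ := h
  obtain ⟨n, hn⟩ := hs.resolve_left hs0
  rw [eq_replicate_black hm] at hn ⊢
  generalize m.length = k at hn ⊢
  rcases u with _ | ⟨x, u⟩
  · rw [List.nil_append, List.nil_append, removeDead_white_cons]
    by_cases hv : white ∈ v
    · left
      -- The swapped white stone leads the row and dies. A black stone leads what remains, so any
      -- further dead stones are black and their loss only raises the excess.
      have e : List.replicate k black ++ black :: v = black :: (List.replicate k black ++ v) := by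
        rw [← List.cons_append, ← List.replicate_succ, List.replicate_succ', List.append_assoc]
        rfl
      rw [e]
      refine ⟨removeDead_black_cons_ne_nil (by simp [hv]), ?_⟩
      refine le_trans ?_ (excess_le_excess_removeDead_black_cons _)
      simp only [excess_append, excess_black_cons, excess_white_cons]
      omega
    · right
      rw [eq_replicate_black hv]
      constructor
      · rw [← List.replicate_succ, ← List.replicate_add]
        have := removeDead_append_replicate_black [] (k + (v.length + 1))
        rwa [List.nil_append] at this
      · simp only [excess_append, excess_black_cons, excess_white_cons, excess_replicate_black]
        -- The row ends in a white stone, so an all-black `v` is empty. The row was `k + 1` black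
        -- stones and one white, of excess `-k`.
        have : v = [] := by
          rcases List.eq_nil_or_concat' v with rfl | ⟨w, y, rfl⟩
          · rfl
          · have e : (black :: (List.replicate k black ++ white :: w)) ++ [y] =
                (black :: n) ++ [white] := by simpa using hn
            obtain rfl : y = white := by simpa using List.append_inj_right' e rfl
            simp at hv
        simp [this]
  -- The leading black stone stays in place, so no white stone dies.
  · obtain rfl : x = black := by simpa using congrArg List.head? hn
    left
    rw [List.cons_append, List.cons_append]
    refine ⟨removeDead_black_cons_ne_nil (by simp), ?_⟩
    refine le_trans ?_ (excess_le_excess_removeDead_black_cons _)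
    simp only [excess_append, excess_black_cons, excess_white_cons]
    omega

/-- On a row with two black stones Left can move the last one past all white stones. -/
theorem exists_leftMove_excess_succ {s : List Stone} (hs : IsRow s) (h2 : 2 ≤ s.count black) :
    ∃ t, LeftMove s t ∧ t ≠ [] ∧ excess t = excess s + 1 := by
  rcases hs with rfl | ⟨m, rfl⟩
  · simp at h2
  have hb : black ∈ m.reverse := by
    rw [List.mem_reverse, ← List.count_pos_iff]
    rw [List.count_cons_self, List.count_append] at h2
    simpa using h2
  -- The first black stone of the reversed list is the last one of `m`; the count guarantees one
  -- besides the head of the row.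
  obtain ⟨w, x, hm, hw⟩ := List.eq_append_cons_of_mem hb
  obtain rfl : m = x.reverse ++ black :: w.reverse := by
    simpa using congrArg List.reverse hm
  have hw' : black ∉ w.reverse := by simpa using hw
  generalize x.reverse = x at *
  rw [eq_replicate_white hw']
  generalize w.reverse.length = k
  have e : x ++ white :: List.replicate k white = x ++ List.replicate k white ++ [white] := by
    rw [List.append_assoc, ← List.replicate_succ, List.replicate_succ']
  -- That black stone is exchanged with the final white stone and dies at the end. The black head of
  -- the row keeps all white stones alive.
  refine ⟨black :: (x ++ List.replicate k white ++ [white]),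
    ⟨black :: x, List.replicate k white, [], by simp, by simp, ?_⟩, by simp, ?_⟩
  · rw [← removeDead_strip, ← e, ← removeDead_append_black]
    simp
  · simp only [excess_append, excess_black_cons, excess_white_cons, excess_nil]
    ring

theorem exists_eq_of_count_black_lt_two {s : List Stone} (hs : IsRow s) (h0 : s ≠ [])
    (h2 : s.count black < 2) : ∃ k, s = black :: List.replicate (k + 1) white := by
  obtain ⟨m, rfl⟩ := hs.resolve_left h0
  have hm : black ∉ m := by
    rw [← List.count_eq_zero]
    rw [List.count_cons_self, List.count_append] at h2
    omega
  exact ⟨m.length, by rw [List.replicate_succ', ← eq_replicate_white hm]⟩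

/-! ### Moves on larvae. -/

theorem leftMove_black_cons_replicate_nil (k : ℕ) :
    LeftMove (black :: List.replicate (k + 1) white) [] := by
  refine ⟨[], List.replicate k white, [], ?_, by simp, ?_⟩
  · rw [List.replicate_succ']; rfl
  · rw [List.nil_append, removeDead_white_cons, removeDead_append_black]
    have := removeDead_replicate_white_append k []
    rw [List.append_nil] at this
    rw [this, removeDead_nil]

theorem leftMove_black_cons_replicate (k : ℕ) :
    LeftMove (black :: List.replicate (k + 2) white) (black :: List.replicate (k + 1) white) := by
  refine ⟨[], [], List.replicate (k + 1) white, rfl, by simp, ?_⟩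
  rw [List.nil_append, removeDead_white_cons, List.nil_append, List.replicate_succ',
    removeDead_strip]

theorem leftMove_replicate_append_white (k : ℕ) :
    LeftMove (List.replicate (k + 2) black ++ [white]) (List.replicate (k + 1) black ++ [white]) := by
  refine ⟨List.replicate (k + 1) black, [], [], ?_, by simp, ?_⟩
  · rw [List.replicate_succ' (n := k + 1)]; simp
  · have e : List.replicate (k + 1) black ++ white :: ([] ++ [black]) =
        black :: (List.replicate k black ++ [white]) ++ [black] := by
      rw [List.replicate_succ]; simp
    rw [e, removeDead_append_black, removeDead_strip, List.replicate_succ, List.cons_append]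

theorem eq_of_rightMove_black_cons {k : ℕ} {t : List Stone}
    (h : RightMove (black :: List.replicate (k + 1) white) t) :
    t = removeDead (black :: List.replicate k white) := by
  obtain ⟨u, m, v, e, hm, rfl⟩ := h
  rcases u with _ | ⟨x, u⟩
  · have e' : List.replicate (k + 1) white = m ++ white :: v := (List.cons.inj e).2
    rcases m with _ | ⟨y, m⟩
    · obtain rfl : List.replicate k white = v := (List.cons.inj e').2
      simp [removeDead_white_cons]
    · obtain rfl : white = y := (List.cons.inj e').1
      simp at hm
  · have e' : List.replicate (k + 1) white = u ++ black :: (m ++ white :: v) := (List.cons.inj e).2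
    have : black ∈ List.replicate (k + 1) white := by rw [e']; simp
    simp at this

theorem eq_of_rightMove_append_white {k : ℕ} {t : List Stone}
    (h : RightMove (List.replicate k black ++ [white]) t) :
    ∃ i < k, t = removeDead (List.replicate i black ++ [white]) := by
  obtain ⟨u, m, v, e, hm, rfl⟩ := h
  have hu : white ∉ u ∧ white ∉ v := by
    have h1 := congrArg (List.count white) e
    simp [List.count_replicate] at h1
    rw [← List.count_eq_zero, ← List.count_eq_zero]
    omega
  have hk := congrArg (List.count black) e
  rw [eq_replicate_black hm, eq_replicate_black hu.1, eq_replicate_black hu.2] at hk ⊢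
  refine ⟨u.length, ?_, ?_⟩
  · simp at hk
    omega
  · rw [← List.replicate_succ, ← List.replicate_add, ← List.singleton_append, ← List.append_assoc,
      removeDead_append_replicate_black]

end Bipass

namespace Bipass

open CGT CGT.Game Stone

/-! ### Winning criteria for sums of strips. -/

/-- The number of strips in a list of rows, empty rows not counted. -/
def size (S : List (List Stone)) : ℕ := (S.map fun s => if s = [] then 0 else 1).sum

theorem size_append (S T : List (List Stone)) : size (S ++ T) = size S + size T := by
  simp [size]

theorem size_cons_of_ne {s : List Stone} (h : s ≠ []) (S : List (List Stone)) :
    size (s :: S) = size S + 1 := by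
  simp [size, h, add_comm]

theorem size_nil_cons (S : List (List Stone)) : size ([] :: S) = size S := by
  simp [size]

theorem totalExcess_append (S T : List (List Stone)) :
    totalExcess (S ++ T) = totalExcess S + totalExcess T := by
  simp [totalExcess]

theorem totalExcess_cons (s : List Stone) (S : List (List Stone)) :
    totalExcess (s :: S) = excess s + totalExcess S := by
  simp [totalExcess]

theorem size_eq_length {S : List (List Stone)} (h : ∀ s ∈ S, s ≠ []) : size S = S.length := by
  induction S with
  | nil => rfl
  | cons s S ih =>
    rw [size_cons_of_ne (h s (by simp)), ih fun t ht => h t (by simp [ht]), List.length_cons]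

theorem exists_ne_nil_of_size_pos {S : List (List Stone)} (h : 0 < size S) :
    ∃ s ∈ S, s ≠ [] := by
  by_contra! h0
  have : size S = 0 := by
    induction S with
    | nil => rfl
    | cons s S ih =>
      obtain rfl := h0 s (by simp)
      rw [size_nil_cons] at h ⊢
      exact ih h fun t ht => h0 t (by simp [ht])
  omega

theorem totalExcess_nonneg {S : List (List Stone)} (h : ∀ s ∈ S, 0 ≤ excess s) :
    0 ≤ totalExcess S :=
  List.sum_nonneg (by simpa using h)

theorem exists_excess_pos {S : List (List Stone)} (h : 0 < totalExcess S) :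
    ∃ s ∈ S, 0 < excess s := by
  by_contra! h0
  have := totalExcess_nonneg (S := S.map conj) (by simpa [excess_conj] using h0)
  rw [totalExcess_map_conj] at this
  omega

theorem exists_excess_neg {S : List (List Stone)} (h : totalExcess S < 0) :
    ∃ s ∈ S, excess s < 0 := by
  by_contra! h0
  have := totalExcess_nonneg h0
  omega

theorem excess_eq_zero_of_totalExcess_nonpos {S : List (List Stone)} (h : ∀ s ∈ S, 0 ≤ excess s)
    (h0 : totalExcess S ≤ 0) {s : List Stone} (hs : s ∈ S) : excess s = 0 := by
  obtain ⟨A, B, rfl⟩ := List.append_of_mem hs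
  rw [totalExcess_append, totalExcess_cons] at h0
  have h1 := totalExcess_nonneg (S := A) fun t ht => h t (by simp [ht])
  have h2 := totalExcess_nonneg (S := B) fun t ht => h t (by simp [ht])
  have h3 := h s hs
  omega

/-- Positions from which Left is shown to win moving first. -/
def FirstCriterion (S : List (List Stone)) : Prop :=
  1 ≤ totalExcess S ∨ (totalExcess S = 0 ∧ Odd (size S))

/-- Positions from which Left is shown to win moving second. -/
def SecondCriterion (S : List (List Stone)) : Prop :=
  2 ≤ totalExcess S ∨ (totalExcess S = 1 ∧ Odd (size S)) ∨
    ((∀ s ∈ S, s = [] ∨ s = [black, white]) ∧ Even (size S))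

/-- By `RightMove.excess`, a move keeping the strip costs at most one unit and preserves the parity
of `size`, while a clearing move costs nothing. In a sum of strips `[black, white]` every move
clears one and flips the parity. -/
theorem secondCriterion_step {A B : List (List Stone)} {s t : List Stone}
    (hrow : ∀ x ∈ A ++ s :: B, IsRow x) (h : SecondCriterion (A ++ s :: B))
    (ht : RightMove s t) : FirstCriterion (A ++ t :: B) := by
  have hx := ht.excess (hrow s (by simp))
  have hs := ht.ne_nil
  simp only [SecondCriterion, FirstCriterion, totalExcess_append, totalExcess_cons, size_append,
    size_cons_of_ne hs] at h ⊢
  rcases h with h | h | ⟨h, he⟩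
  · left
    rcases hx with ⟨h0, hx⟩ | ⟨rfl, hx⟩
    · omega
    · rw [excess_nil]; omega
  · rcases hx with ⟨h0, hx⟩ | ⟨rfl, hx⟩
    · rw [size_cons_of_ne h0]
      rcases eq_or_lt_of_le hx with hx | hx
      · exact .inr ⟨by omega, h.2⟩
      · left; omega
    · rw [excess_nil]; left; omega
  · obtain rfl := (h s (by simp)).resolve_left hs
    obtain rfl : t = [] := eq_of_rightMove_black_cons (k := 0) ht
    right
    have hz : ∀ S : List (List Stone), (∀ x ∈ S, x = [] ∨ x = [black, white]) →
        totalExcess S = 0 := by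
      intro S hS
      induction S with
      | nil => rfl
      | cons x S ih =>
        rw [totalExcess_cons, ih fun y hy => hS y (by simp [hy])]
        rcases hS x (by simp) with rfl | rfl <;> rfl
    rw [hz A fun x hx => h x (by simp [hx]), hz B fun x hx => h x (by simp [hx]), size_nil_cons]
    refine ⟨rfl, ?_⟩
    rw [← add_assoc] at he
    by_contra hodd
    exact (Nat.not_even_iff_odd.2 (Nat.not_odd_iff_even.1 hodd).add_one) he

theorem excess_black_cons_replicate (k : ℕ) :
    excess (black :: List.replicate (k + 1) white) = k := by
  rw [excess_black_cons, excess_replicate_white]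
  push_cast
  ring

/-- Each non-empty row is one black stone and `k + 1` white ones, of excess `k ≥ 0`. Left can clear
it or, if `k ≥ 1`, remove one white stone. Which move meets `SecondCriterion` depends on the total
excess and the parity. -/
theorem exists_move_of_count_black_lt_two {S : List (List Stone)} (hrow : ∀ s ∈ S, IsRow s)
    (h2 : ∀ s ∈ S, s.count black < 2) (h : FirstCriterion S) :
    ∃ A s B t, S = A ++ s :: B ∧ LeftMove s t ∧ SecondCriterion (A ++ t :: B) := by
  have hform : ∀ s ∈ S, s ≠ [] → ∃ k, s = black :: List.replicate (k + 1) white :=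
    fun s hs h0 => exists_eq_of_count_black_lt_two (hrow s hs) h0 (h2 s hs)
  have hnn : ∀ s ∈ S, 0 ≤ excess s := by
    intro s hs
    by_cases h0 : s = []
    · simp [h0, excess_nil]
    · obtain ⟨k, rfl⟩ := hform s hs h0
      rw [excess_black_cons_replicate]
      omega
  have hbw : ∀ s ∈ S, excess s = 0 → s = [] ∨ s = [black, white] := by
    intro s hs hz
    by_cases h0 : s = []
    · exact .inl h0
    · obtain ⟨k, rfl⟩ := hform s hs h0
      rw [excess_black_cons_replicate] at hz
      obtain rfl : k = 0 := by omega
      exact .inr rfl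
  have hdel : ∀ s ∈ S, s ≠ [] → LeftMove s [] := by
    intro s hs h0
    obtain ⟨k, rfl⟩ := hform s hs h0
    exact leftMove_black_cons_replicate_nil k
  have hodd : ∀ {n : ℕ}, Odd (n + 1) → Even n := fun {n} h => by
    by_contra h'
    exact Nat.not_odd_iff_even.2 (Nat.not_even_iff_odd.1 h').add_one h
  have heven : ∀ {n : ℕ}, Even (n + 1) → Odd n := fun {n} h => by
    by_contra h'
    exact Nat.not_even_iff_odd.2 (Nat.not_odd_iff_even.1 h').add_one h
  have hsz : ∀ (A B : List (List Stone)) (s : List Stone), s ≠ [] →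
      size (A ++ s :: B) = size (A ++ [] :: B) + 1 := by
    intro A B s h0
    rw [size_append, size_append, size_cons_of_ne h0, size_nil_cons, add_assoc]
  have hex : ∀ (A B : List (List Stone)) (s t : List Stone),
      totalExcess (A ++ t :: B) = totalExcess (A ++ s :: B) - excess s + excess t := by
    intro A B s t
    simp only [totalExcess_append, totalExcess_cons]
    ring
  rcases h with h | ⟨h, hn⟩
  · obtain ⟨s, hs, hpos⟩ := exists_excess_pos (S := S) (by omega)
    have h0 : s ≠ [] := by rintro rfl; simp [excess_nil] at hpos
    obtain ⟨k, hk⟩ := hform s hs h0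
    obtain ⟨A, B, hS⟩ := List.append_of_mem hs
    have hk' : excess s = k := by rw [hk, excess_black_cons_replicate]
    obtain ⟨l, rfl⟩ : ∃ l, k = l + 1 := ⟨k - 1, by omega⟩
    have hrest : ∀ x ∈ A ++ B, x ∈ S := fun x hx => by
      rw [hS]
      simp only [List.mem_append, List.mem_cons] at hx ⊢
      tauto
    have hAB : totalExcess (A ++ B) = totalExcess S - excess s := by
      rw [hS]
      simp only [totalExcess_append, totalExcess_cons]
      ring
    have hABn : 0 ≤ totalExcess (A ++ B) := totalExcess_nonneg fun x hx => hnn x (hrest x hx)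
    have hABs : size S = size (A ++ B) + 1 := by
      rw [hS, size_append, size_append, size_cons_of_ne h0, add_assoc]
    -- Here one unit of excess can be spared, so shortening `s` works. What remains is total excess
    -- 1, or total excess 2 with an even number of strips.
    by_cases hshort : 3 ≤ totalExcess S ∨ (totalExcess S = 2 ∧ Odd (size S))
    · refine ⟨A, s, B, _, hS, hk ▸ leftMove_black_cons_replicate l, ?_⟩
      have e := hex A B s (black :: List.replicate (l + 1) white)
      rw [← hS, excess_black_cons_replicate, hk'] at e
      push_cast at e
      rcases hshort with h3 | ⟨h3, hn⟩
      · left; omega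
      · refine .inr (.inl ⟨by omega, ?_⟩)
        rw [hS, hsz A B s h0] at hn
        rwa [hsz A B _ (by simp)]
    push Not at hshort
    -- All the excess sits in `s`, and an odd number of strips `[black, white]` surrounds it.
    -- Clearing one of these keeps the excess and makes the number of strips odd.
    by_cases hex0 : totalExcess (A ++ B) ≤ 0 ∧ Even (size S)
    · obtain ⟨x, hx, hx0⟩ := exists_ne_nil_of_size_pos (S := A ++ B)
        (heven (hABs ▸ hex0.2)).pos
      have hxz := excess_eq_zero_of_totalExcess_nonpos (fun y hy => hnn y (hrest y hy)) hex0.1 hx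
      obtain ⟨A', B', hS'⟩ := List.append_of_mem (hrest x hx)
      refine ⟨A', x, B', [], hS', hdel x (hrest x hx) hx0, ?_⟩
      have e := hex A' B' x []
      rw [← hS', hxz, excess_nil] at e
      by_cases h1 : totalExcess S = 1
      · refine .inr (.inl ⟨by omega, heven ?_⟩)
        rw [← hsz A' B' x hx0, ← hS']
        exact hex0.2
      · left; omega
    -- Clearing `s` leaves total excess 1 on an odd number of strips if the number was even. If it
    -- was odd, the total excess was 1, and an even number of strips `[black, white]` is left.
    · refine ⟨A, s, B, [], hS, hdel s hs h0, ?_⟩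
      have e := hex A B s []
      rw [← hS, hk', excess_nil] at e
      push_cast at e hk'
      by_cases hev : Even (size S)
      · have h1 : ¬ totalExcess (A ++ B) ≤ 0 := fun h => hex0 ⟨h, hev⟩
        refine .inr (.inl ⟨by omega, heven ?_⟩)
        rw [← hsz A B s h0, ← hS]
        exact hev
      · have hn := Nat.not_even_iff_odd.1 hev
        have h1 : totalExcess S ≠ 2 := fun h => hev (Nat.not_odd_iff_even.1 (hshort.2 h))
        refine .inr (.inr ⟨fun x hx => ?_, hodd ?_⟩)
        · rcases List.mem_append.1 hx with hx | hx
          · have hx' : x ∈ A ++ B := by simp [hx]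
            exact hbw x (hrest x hx') (excess_eq_zero_of_totalExcess_nonpos
              (fun y hy => hnn y (hrest y hy)) (by omega) hx')
          · rcases List.mem_cons.1 hx with rfl | hx
            · exact .inl rfl
            · have hx' : x ∈ A ++ B := by simp [hx]
              exact hbw x (hrest x hx') (excess_eq_zero_of_totalExcess_nonpos
                (fun y hy => hnn y (hrest y hy)) (by omega) hx')
        · rw [← hsz A B s h0, ← hS]
          exact hn
  -- Total excess 0 forces every strip to be `[black, white]`; clearing one makes their number even.
  · obtain ⟨s, hs, h0⟩ := exists_ne_nil_of_size_pos hn.pos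
    obtain ⟨A, B, hS⟩ := List.append_of_mem hs
    refine ⟨A, s, B, [], hS, hdel s hs h0, .inr (.inr ⟨fun x hx => ?_, hodd ?_⟩)⟩
    · by_cases hx0 : x = []
      · exact .inl hx0
      · have hxS : x ∈ S := by
          rw [hS]
          simp only [List.mem_append, List.mem_cons] at hx ⊢
          tauto
        exact hbw x hxS (excess_eq_zero_of_totalExcess_nonpos hnn h.le hxS)
    · rw [← hsz A B s h0, ← hS]
      exact hn

theorem exists_move_of_firstCriterion {S : List (List Stone)} (hrow : ∀ s ∈ S, IsRow s)
    (h : FirstCriterion S) :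
    ∃ A s B t, S = A ++ s :: B ∧ LeftMove s t ∧ SecondCriterion (A ++ t :: B) := by
  by_cases h2 : ∀ s ∈ S, s.count black < 2
  · exact exists_move_of_count_black_lt_two hrow h2 h
  · push Not at h2
    obtain ⟨s, hs, h2⟩ := h2
    obtain ⟨t, hm, h0, he⟩ := exists_leftMove_excess_succ (hrow s hs) h2
    obtain ⟨A, B, rfl⟩ := List.append_of_mem hs
    refine ⟨A, s, B, t, rfl, hm, ?_⟩
    have hs0 : s ≠ [] := by rintro rfl; simp at h2
    simp only [FirstCriterion, SecondCriterion, totalExcess_append, totalExcess_cons, size_append,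
      size_cons_of_ne hs0, size_cons_of_ne h0, he] at h ⊢
    rcases h with h | ⟨h, hn⟩
    · left; omega
    · exact .inr (.inl ⟨by omega, hn⟩)

/-- The total number of inversions. -/
def totalInversions (S : List (List Stone)) : ℕ := (S.map inversions).sum

theorem totalInversions_lt {A B : List (List Stone)} {s t : List Stone}
    (h : inversions t < inversions s) :
    totalInversions (A ++ t :: B) < totalInversions (A ++ s :: B) := by
  simp [totalInversions, h]

theorem forall_isRow_replace {A B : List (List Stone)} {s t : List Stone}
    (h : ∀ x ∈ A ++ s :: B, IsRow x) (ht : IsRow t) : ∀ x ∈ A ++ t :: B, IsRow x := by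
  intro x hx
  rcases List.mem_append.1 hx with hx | hx
  · exact h x (by simp [hx])
  · rcases List.mem_cons.1 hx with rfl | hx
    · exact ht
    · exact h x (by simp [hx])

theorem leftWins_sumGame {S : List (List Stone)} (hrow : ∀ s ∈ S, IsRow s) :
    (FirstCriterion S → LeftWins true (sumGame S)) ∧
      (SecondCriterion S → LeftWins false (sumGame S)) := by
  induction hn : totalInversions S using Nat.strong_induction_on generalizing S with
  | _ n ih =>
    subst hn
    constructor
    · intro h
      obtain ⟨A, s, B, t, rfl, hm, hc⟩ := exists_move_of_firstCriterion hrow h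
      exact (leftWins_true_iff _).2 ⟨_, (isLeftOption_sumGame _ _).2 ⟨A, s, B, t, rfl, hm, rfl⟩,
        (ih _ (totalInversions_lt hm.inversions_lt) (forall_isRow_replace hrow hm.isRow) rfl).2 hc⟩
    · intro h
      rw [leftWins_false_iff]
      simp only [isRightOption_sumGame]
      rintro _ ⟨A, s, B, t, rfl, hm, rfl⟩
      exact (ih _ (totalInversions_lt hm.inversions_lt)
        (forall_isRow_replace hrow hm.isRow) rfl).1 (secondCriterion_step hrow h hm)

/-! ### Sums of larvae. -/

theorem IsLarva.isRow {s : List Stone} (h : IsLarva s) : IsRow s := by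
  obtain ⟨k, hk, rfl | rfl⟩ := h
  · obtain ⟨k, rfl⟩ : ∃ l, k = l + 1 := ⟨k - 1, by omega⟩
    exact .inr ⟨List.replicate k white, by rw [List.replicate_succ']⟩
  · obtain ⟨k, rfl⟩ : ∃ l, k = l + 1 := ⟨k - 1, by omega⟩
    exact .inr ⟨List.replicate k black, rfl⟩

theorem IsLarva.conj {s : List Stone} (h : IsLarva s) : IsLarva (conj s) := by
  obtain ⟨k, hk, rfl | rfl⟩ := h
  · exact ⟨k, hk, .inr (by simp [Bipass.conj, Stone.swap])⟩
  · exact ⟨k, hk, .inl (by simp [Bipass.conj, Stone.swap])⟩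

theorem IsLarva.ne_nil {s : List Stone} (h : IsLarva s) : s ≠ [] := by
  obtain ⟨k, hk, rfl | rfl⟩ := h <;> simp

/-- On a black headed larva Right can only swap the first two stones, which kills one white stone.
On a white headed one the black stones passed by the white stone die, so a move that does not clear
it raises the excess. -/
theorem IsLarva.rightMove {s t : List Stone} (hs : IsLarva s) (h : RightMove s t) :
    (t = [] ∧ excess s ≤ 0) ∨ excess s < excess t ∨ (IsLarva t ∧ excess t = excess s - 1) := by
  have hx := h.excess hs.isRow
  by_cases h0 : t = []
  · exact .inl ⟨h0, (hx.resolve_left fun h => h.1 h0).2⟩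
  obtain ⟨k, hk, rfl | rfl⟩ := hs
  · obtain ⟨k, rfl⟩ : ∃ l, k = l + 1 := ⟨k - 1, by omega⟩
    obtain rfl := eq_of_rightMove_black_cons h
    rcases k with _ | k
    · exact (h0 rfl).elim
    · right; right
      have e : removeDead (black :: List.replicate (k + 1) white) =
          black :: List.replicate (k + 1) white := by
        rw [List.replicate_succ', removeDead_strip]
      rw [e, excess_black_cons_replicate, excess_black_cons_replicate]
      exact ⟨⟨k + 1, by omega, .inl rfl⟩, by push_cast; ring⟩
  · obtain ⟨i, hi, rfl⟩ := eq_of_rightMove_append_white h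
    rcases i with _ | i
    · exact (h0 rfl).elim
    · right; left
      rw [List.replicate_succ, List.cons_append, removeDead_strip]
      simp only [excess_append, excess_black_cons, excess_replicate_black]
      omega

theorem IsLarva.exists_leftMove {s : List Stone} (hs : IsLarva s) (h : excess s < 0) :
    ∃ t, LeftMove s t ∧ IsLarva t ∧ excess t = excess s + 1 := by
  obtain ⟨k, hk, rfl | rfl⟩ := hs
  · rw [excess_black_cons, excess_replicate_white] at h
    omega
  · simp only [excess_append, excess_replicate_black, excess_white_cons, excess_nil] at h
    obtain ⟨k, rfl⟩ : ∃ l, k = l + 2 := ⟨k - 2, by omega⟩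
    refine ⟨_, leftMove_replicate_append_white k, ⟨k + 1, by omega, .inr rfl⟩, ?_⟩
    simp only [excess_append, excess_replicate_black]
    push_cast
    ring

/-- If Right clears a larva or raises the excess, the position meets `FirstCriterion`. Otherwise he
has lowered the excess by one within the larvae, and Left restores it on a larva of negative excess.
-/
theorem leftWins_sumGame_larvae {S : List (List Stone)} (hS : ∀ s ∈ S, IsLarva s)
    (h0 : totalExcess S = 0) (hn : Even S.length) : LeftWins false (sumGame S) := by
  induction hN : totalInversions S using Nat.strong_induction_on generalizing S with
  | _ N ih =>
    subst hN
    rw [leftWins_false_iff]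
    simp only [isRightOption_sumGame]
    rintro _ ⟨A, s, B, t, rfl, hm, rfl⟩
    have hrow := forall_isRow_replace (fun x hx => (hS x hx).isRow) hm.isRow
    have hsize : size (A ++ s :: B) = (A ++ s :: B).length :=
      size_eq_length fun x hx => (hS x hx).ne_nil
    have hs := hS s (by simp)
    have hex : totalExcess (A ++ t :: B) = excess t - excess s := by
      simp only [totalExcess_append, totalExcess_cons] at h0 ⊢
      omega
    rcases hs.rightMove hm with ⟨rfl, he⟩ | he | ⟨ht, he⟩
    · refine (leftWins_sumGame hrow).1 ?_
      rcases eq_or_lt_of_le he with he | he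
      · refine .inr ⟨by rw [hex, he, excess_nil]; rfl, ?_⟩
        rw [← hsize, size_append, size_cons_of_ne hs.ne_nil, ← add_assoc] at hn
        rw [size_append, size_nil_cons]
        by_contra h
        exact Nat.not_even_iff_odd.2 (Nat.not_odd_iff_even.1 h).add_one hn
      · left
        rw [hex, excess_nil]
        omega
    · exact (leftWins_sumGame hrow).1 (.inl (by omega))
    · have hL : ∀ x ∈ A ++ t :: B, IsLarva x := by
        intro x hx
        rcases List.mem_append.1 hx with hx | hx
        · exact hS x (by simp [hx])
        · rcases List.mem_cons.1 hx with rfl | hx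
          · exact ht
          · exact hS x (by simp [hx])
      obtain ⟨x, hx, hxneg⟩ := exists_excess_neg (S := A ++ t :: B) (by omega)
      obtain ⟨y, hxy, hy, hye⟩ := (hL x hx).exists_leftMove hxneg
      have hlt := totalInversions_lt (A := A) (B := B) hm.inversions_lt
      have hlen : (A ++ t :: B).length = (A ++ s :: B).length := by simp
      -- Left's reply may be on a different strip, so the decomposition around Right's move is
      -- forgotten.
      generalize A ++ t :: B = T at *
      obtain ⟨A', B', rfl⟩ := List.append_of_mem hx
      refine (leftWins_true_iff _).2 ⟨_, (isLeftOption_sumGame _ _).2 ⟨A', x, B', y, rfl, hxy, rfl⟩,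
        ih _ ((totalInversions_lt hxy.inversions_lt).trans hlt) ?_ ?_ ?_ rfl⟩
      · intro z hz
        rcases List.mem_append.1 hz with hz | hz
        · exact hL z (by simp [hz])
        · rcases List.mem_cons.1 hz with rfl | hz
          · exact hy
          · exact hL z (by simp [hz])
      · simp only [totalExcess_append, totalExcess_cons] at hex ⊢
        omega
      · rw [← hlen] at hn
        simpa using hn

/-! Comparison of values -/

theorem not_value_sumGame_nonpos {S : List (List Stone)} (hrow : ∀ s ∈ S, IsRow s)
    (h : FirstCriterion S) : ¬ value (sumGame S) ≤ 0 := by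
  rw [← value_zero, value_le_iff, le_zero_iff, not_not]
  exact (leftWins_sumGame hrow).1 h

theorem value_sumGame_nonneg {S : List (List Stone)} (hrow : ∀ s ∈ S, IsRow s)
    (h : SecondCriterion S) : 0 ≤ value (sumGame S) := by
  rw [← value_zero, value_le_iff, zero_le_iff]
  exact (leftWins_sumGame hrow).2 h

theorem identical_stripGame_nil : Identical (stripGame []) 0 := by
  rw [identical_iff]
  simp [isLeftOption_stripGame, isRightOption_stripGame, not_isLeftOption_zero,
    not_isRightOption_zero, LeftMove, RightMove]

theorem value_stripGame_nil : value (stripGame []) = 0 :=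
  value_eq_iff.2 identical_stripGame_nil.equivalent

theorem rightMove_black_white (t : List Stone) : RightMove [black, white] t ↔ t = [] :=
  ⟨fun h => eq_of_rightMove_black_cons (k := 0) h, fun h => ⟨[], [], [], by simp, by simp, h⟩⟩

theorem leftMove_black_white (t : List Stone) : LeftMove [black, white] t ↔ t = [] := by
  constructor
  · intro h
    have h1 : t = conj [] := by
      rw [← (rightMove_black_white _).1 h.conj, conj_conj]
    exact h1
  · rintro rfl
    exact leftMove_black_cons_replicate_nil 0

theorem value_stripGame_black_white : value (stripGame [black, white]) = value star := by
  refine value_eq_iff.2 (Identical.equivalent ?_)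
  rw [identical_iff, Game.star]
  simp only [isLeftOption_stripGame, isRightOption_stripGame, leftMove_black_white,
    rightMove_black_white, isLeftOption_ofOptions, isRightOption_ofOptions, exists_eq_left,
    forall_eq, identical_stripGame_nil, and_self]

/-- The strip is `{0, * | *}` in value. Compared with `↑ = {0 | *}` it has the extra Left option
`*`, which is reversible: Right's answer to 0 satisfies `0 ≤ ↑`. -/
theorem value_stripGame_black_white_white :
    value (stripGame [black, white, white]) = value up := by
  have hbw : Equivalent (stripGame [black, white]) star :=
    value_eq_iff.1 value_stripGame_black_white
  have hnil : Equivalent (stripGame []) 0 := value_eq_iff.1 value_stripGame_nil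
  have hR : ∀ K, IsRightOption (stripGame [black, white, white]) K ↔
      K = stripGame [black, white] := by
    intro K
    rw [isRightOption_stripGame]
    constructor
    · rintro ⟨t, ht, rfl⟩
      rw [eq_of_rightMove_black_cons (k := 1) ht]
      rfl
    · rintro rfl
      exact ⟨_, ⟨[], [], [white], rfl, by simp, rfl⟩, rfl⟩
  have hL : ∀ K, IsLeftOption (stripGame [black, white, white]) K →
      K = stripGame [] ∨ K = stripGame [black, white] := by
    intro K
    rw [isLeftOption_stripGame]
    rintro ⟨t, ⟨u, m, v, e, hm, rfl⟩, rfl⟩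
    obtain ⟨rfl, e2⟩ : u = [] ∧ [white, white] = m ++ white :: v := by
      rcases u with _ | ⟨x, u⟩
      · exact ⟨rfl, (List.cons.inj e).2⟩
      · have e' : List.replicate 2 white = u ++ black :: (m ++ white :: v) := (List.cons.inj e).2
        have : black ∈ List.replicate 2 white := by rw [e']; simp
        simp at this
    clear e
    rcases m with _ | ⟨y, m⟩
    · obtain rfl : [white] = v := (List.cons.inj e2).2
      exact .inr rfl
    · obtain ⟨rfl, e3⟩ := List.cons.inj e2
      rcases m with _ | ⟨z, m⟩
      · obtain rfl : [] = v := (List.cons.inj e3).2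
        exact .inl rfl
      · have := (List.cons.inj e3).2
        simp at this
  have hupL : IsLeftOption up 0 := (isLeftOption_ofOptions _ _ _).2 rfl
  have hupR : IsRightOption up star := (isRightOption_ofOptions _ _ _).2 rfl
  have h0up : (0 : Game) ≤ up := by
    refine (le_iff_options _ _).2 ⟨fun K hK => (not_isLeftOption_zero K hK).elim, fun K hK h => ?_⟩
    obtain rfl := (isRightOption_ofOptions _ _ _).1 hK
    exact ((le_iff_options _ _).1 h).1 0 ((isLeftOption_ofOptions _ _ _).2 rfl) le_rfl
  refine value_eq_iff.2 ⟨?_, ?_⟩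
  · refine (le_iff_options _ _).2 ⟨fun K hK h => ?_, fun K hK h => ?_⟩
    · rcases hL K hK with rfl | rfl
      · exact ((le_iff_options _ _).1 (h.trans hnil.1)).1 0 hupL le_rfl
      · exact ((le_iff_options _ _).1 (h.trans hbw.1)).2 0
          ((isRightOption_ofOptions _ _ _).2 rfl) h0up
    · obtain rfl := (isRightOption_ofOptions _ _ _).1 hK
      exact ((le_iff_options _ _).1 h).2 _ ((hR _).2 rfl) hbw.1
  · refine (le_iff_options _ _).2 ⟨fun K hK h => ?_, fun K hK h => ?_⟩
    · obtain rfl := (isLeftOption_ofOptions _ _ _).1 hK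
      -- The single strip has excess 1, so Left wins it moving first and it is not `≤ 0`.
      refine not_value_sumGame_nonpos (S := [[black, white, white]]) ?_ (.inl ?_) ?_
      · intro s hs
        obtain rfl := List.mem_singleton.1 hs
        exact .inr ⟨[white], rfl⟩
      · decide
      · rw [value_sumGame_cons, value_sumGame_nil, add_zero, ← value_zero]
        exact value_le_iff.2 h
    · obtain rfl := (hR K).1 hK
      exact ((le_iff_options _ _).1 (hbw.2.trans h)).2 star hupR le_rfl

theorem value_upStar : value upStar = value up + value star := rfl

theorem value_down : value down = -value up := by rw [← neg_up, value_neg]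

theorem neg_value_star : -value star = value star := by rw [← value_neg, neg_star]

theorem value_downStar : value downStar = -(value up + value star) := by
  rw [neg_add, neg_value_star, ← value_down]; rfl

theorem totalExcess_black_white_cons (S : List (List Stone)) :
    totalExcess ([black, white] :: S) = totalExcess S := by
  rw [totalExcess_cons]
  exact zero_add _

theorem totalExcess_black_white_white_cons (S : List (List Stone)) :
    totalExcess ([black, white, white] :: S) = 1 + totalExcess S :=
  totalExcess_cons _ _

theorem value_sumGame_of_forall_star {S : List (List Stone)}
    (h : ∀ s ∈ S, Equivalent (stripGame s) star) (hodd : Odd S.length) :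
    value (sumGame S) = value star := by
  have h1 : ∀ T : List (List Stone), (∀ s ∈ T, Equivalent (stripGame s) star) →
      value (sumGame T) = T.length • value star := by
    intro T hT
    induction T with
    | nil => rw [value_sumGame_nil, List.length_nil, zero_nsmul]
    | cons s T ih =>
      rw [value_sumGame_cons, value_eq_iff.2 (hT s (by simp)), ih fun t ht => hT t (by simp [ht]),
        List.length_cons, succ_nsmul']
  obtain ⟨k, hk⟩ := hodd
  rw [h1 S h, hk, add_nsmul, mul_nsmul, two_nsmul, one_nsmul, value_star_add_self,
    nsmul_zero, zero_add]

/-- Larvae with total excess 0 are stable under reflection, so both the value and its negative are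
nonnegative. -/
theorem value_sumGame_larvae {S : List (List Stone)} (hS : ∀ s ∈ S, IsLarva s)
    (h0 : totalExcess S = 0) (hn : Even S.length) : value (sumGame S) = 0 := by
  have hnonneg : ∀ T : List (List Stone), (∀ s ∈ T, IsLarva s) → totalExcess T = 0 →
      Even T.length → 0 ≤ value (sumGame T) := fun T hT h0 hn =>
    value_le_iff.2 ((zero_le_iff _).2 (leftWins_sumGame_larvae hT h0 hn))
  refine le_antisymm ?_ (hnonneg S hS h0 hn)
  have h := hnonneg (S.map conj) (by simpa using fun s hs => (hS s hs).conj)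
    (by rw [totalExcess_map_conj, h0, neg_zero]) (by rwa [List.length_map])
  rwa [value_sumGame_map_conj, neg_nonneg] at h

/-- The assertions about an upper bound, which give those about a lower bound by symmetry. -/
theorem value_sumGame_upper {S : List (List Stone)} (hrow : ∀ s ∈ S, IsRow s)
    (h0 : totalExcess S = 0) :
    (Odd (size S) →
      ¬ value (sumGame S) ≤ 0 ∧ 0 < value (sumGame S) + (value up + value star) ∧
        ¬ value (sumGame S) + value up ≤ 0) ∧
    (Even (size S) →
      ¬ value (sumGame S) + value star ≤ 0 ∧ 0 < value (sumGame S) + value up ∧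
        ¬ value (sumGame S) + (value up + value star) ≤ 0) := by
  have hbw : IsRow [black, white] := .inr ⟨[], rfl⟩
  have hbww : IsRow [black, white, white] := .inr ⟨[white], rfl⟩
  have hrow1 : ∀ s ∈ [black, white] :: S, IsRow s := List.forall_mem_cons.2 ⟨hbw, hrow⟩
  have hrow2 : ∀ s ∈ [black, white, white] :: S, IsRow s := List.forall_mem_cons.2 ⟨hbww, hrow⟩
  have hrow3 : ∀ s ∈ [black, white, white] :: [black, white] :: S, IsRow s :=
    List.forall_mem_cons.2 ⟨hbww, hrow1⟩
  -- The added infinitesimals are themselves strips, so each comparison with zero concerns a longer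
  -- sum of strips.
  have e1 : value (sumGame S) + value star = value (sumGame ([black, white] :: S)) := by
    rw [value_sumGame_cons, value_stripGame_black_white, add_comm]
  have e2 : value (sumGame S) + value up = value (sumGame ([black, white, white] :: S)) := by
    rw [value_sumGame_cons, value_stripGame_black_white_white, add_comm]
  have e3 : value (sumGame S) + (value up + value star) =
      value (sumGame ([black, white, white] :: [black, white] :: S)) := by
    rw [value_sumGame_cons, value_sumGame_cons, value_stripGame_black_white_white,
      value_stripGame_black_white, add_comm, add_assoc]
  have x1 : totalExcess ([black, white] :: S) = 0 := by rw [totalExcess_black_white_cons, h0]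
  have x2 : totalExcess ([black, white, white] :: S) = 1 := by
    rw [totalExcess_black_white_white_cons, h0, add_zero]
  have x3 : totalExcess ([black, white, white] :: [black, white] :: S) = 1 := by
    rw [totalExcess_black_white_white_cons, x1, add_zero]
  have n1 : size ([black, white] :: S) = size S + 1 := size_cons_of_ne (by simp) S
  have n2 : size ([black, white, white] :: S) = size S + 1 := size_cons_of_ne (by simp) S
  have n3 : size ([black, white, white] :: [black, white] :: S) = size S + 1 + 1 := by
    rw [size_cons_of_ne (by simp), n1]
  rw [e1, e2, e3]
  refine ⟨fun hn => ⟨not_value_sumGame_nonpos hrow (.inr ⟨h0, hn⟩), lt_of_le_not_ge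
    (value_sumGame_nonneg hrow3 (.inr (.inl ⟨x3, n3 ▸ hn.add_one.add_one⟩)))
    (not_value_sumGame_nonpos hrow3 (.inl x3.ge)),
    not_value_sumGame_nonpos hrow2 (.inl x2.ge)⟩,
    fun hn => ⟨not_value_sumGame_nonpos hrow1 (.inr ⟨x1, n1 ▸ hn.add_one⟩), lt_of_le_not_ge
    (value_sumGame_nonneg hrow2 (.inr (.inl ⟨x2, n2 ▸ hn.add_one⟩)))
    (not_value_sumGame_nonpos hrow2 (.inl x2.ge)),
    not_value_sumGame_nonpos hrow3 (.inl x3.ge)⟩⟩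

end Bipass

open CGT Bipass
theorem mainTheorem4 (S : List (List Stone)) (hS : ∀ s ∈ S, IsStrip s)
    (hΔ : totalExcess S = 0) :
    (Odd S.length →
      Game.Fuzzy (sumGame S) 0 ∧
      ((∀ s ∈ S, Game.Equivalent (stripGame s) Game.star) → Game.Equivalent (sumGame S) Game.star) ∧
      (Game.downStar < sumGame S ∧ sumGame S < Game.upStar) ∧
      (Game.LessOrFuzzy Game.down (sumGame S) ∧ Game.LessOrFuzzy (sumGame S) Game.up)) ∧
    (Even S.length →
      Game.Fuzzy (sumGame S) Game.star ∧
      ((∀ s ∈ S, IsLarva s) → Game.Equivalent (sumGame S) 0) ∧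
      (Game.down < sumGame S ∧ sumGame S < Game.up) ∧
      (Game.LessOrFuzzy Game.downStar (sumGame S) ∧ Game.LessOrFuzzy (sumGame S) Game.upStar)) := by
  have hrow : ∀ s ∈ S, IsRow s := fun s hs => .inr (hS s hs).exists_eq
  have hrow' : ∀ s ∈ S.map conj, IsRow s := by
    simpa using fun s hs => (hrow s hs).conj
  have hsize : size S = S.length := size_eq_length fun s hs => (hS s hs).1
  have hsize' : size (S.map conj) = S.length := by
    rw [size_eq_length, List.length_map]
    simp only [List.forall_mem_map, ne_eq, conj_eq_nil]
    exact fun s hs => (hS s hs).1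
  have hΔ' : totalExcess (S.map conj) = 0 := by rw [totalExcess_map_conj, hΔ, neg_zero]
  have hu := value_sumGame_upper hrow hΔ
  -- The reflected sum has value `-g`, so its upper bounds are the lower bounds for `g`.
  have hl := value_sumGame_upper hrow' hΔ'
  rw [hsize] at hu
  rw [hsize', value_sumGame_map_conj] at hl
  simp only [Game.fuzzy_iff, Game.lessOrFuzzy_iff, ← Game.value_lt_iff, ← Game.value_eq_iff,
    value_downStar, value_upStar, value_down, Game.value_zero]
  have larvae : Even S.length → (∀ s ∈ S, IsLarva s) → Game.value (sumGame S) = 0 :=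
    fun hn h => value_sumGame_larvae h hΔ hn
  have stars : Odd S.length → (∀ s ∈ S, Game.value (stripGame s) = Game.value Game.star) →
      Game.value (sumGame S) = Game.value Game.star :=
    fun hn h => value_sumGame_of_forall_star (fun s hs => Game.value_eq_iff.1 (h s hs)) hn
  have hstar := neg_value_star
  -- What remains is algebra in an ordered abelian group containing an element `x` with `-x = x`.
  generalize Game.value (sumGame S) = g at *
  generalize Game.value Game.star = x at *
  generalize Game.value Game.up = y at *
  refine ⟨fun hn => ?_, fun hn => ?_⟩
  · obtain ⟨u1, u2, u3⟩ := hu.1 hn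
    obtain ⟨l1, l2, l3⟩ := hl.1 hn
    refine ⟨⟨u1, fun h => l1 (neg_nonpos.2 h)⟩, stars hn, ⟨neg_lt_iff_pos_add.2 u2, ?_⟩,
      fun h => u3 (le_neg_iff_add_nonpos_right.1 h), fun h => l3 ?_⟩
    · rwa [neg_add_eq_sub, sub_pos] at l2
    · rwa [neg_add_eq_sub, sub_nonpos]
  · obtain ⟨u1, u2, u3⟩ := hu.2 hn
    obtain ⟨l1, l2, l3⟩ := hl.2 hn
    refine ⟨⟨fun h => u1 ?_, fun h => l1 ?_⟩, larvae hn, ⟨neg_lt_iff_pos_add.2 u2, ?_⟩,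
      fun h => u3 (le_neg_iff_add_nonpos_right.1 h), fun h => l3 ?_⟩
    · rwa [← hstar, ← sub_eq_add_neg, sub_nonpos]
    · rwa [neg_add_eq_sub, sub_nonpos]
    · rwa [neg_add_eq_sub, sub_pos] at l2
    · rwa [neg_add_eq_sub, sub_nonpos]
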